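/- Let $p\neq q$ be odd primes, $n=pq$, and let $f\in\mathbb Z_n[x]$ have degree $r$ and invertible leading coefficient, with both reductions $f_p\in\mathbb F_p[x]$ and $f_q\in\mathbb F_q[x]$ irreducible and $f(0)$ invertible in $\mathbb Z_n$ (so that the singular points of $y^2=xf(x)^2$ modulo $p$ and modulo $q$ are nodes). Let $N: y^2=xf(x)^2$ over $\mathbb Z_n$, let $N_p,N_q$ be its reductions, and let $\mathrm{Jac}$ of such a curve denote the ideal class group (the Picard group) of its coordinate ring $R[x,y]/(y^2-xf(x)^2)$. A polynomial $t\in\mathbb Z_n[x]$ with $\deg t<r$ and $f,\ x-t^2$ generating the unit ideal of $\mathbb Z_n[x]$ is called admissible. 1. The reduction maps induce an isomorphism $\mathrm{Jac}(N)\cong\mathrm{Jac}(N_p)\oplus\mathrm{Jac}(N_q)$. Moreover $|\mathrm{Jac}(N_p)|$ equals $p^r-1$ if $x$ is a square in $\mathbb F_p[x]/(f_p)$ and $p^r+1$ otherwise, and likewise for $q$. Hence $\mathrm{Jac}(N)$ has order $\mathcal K=|\mathrm{Jac}(N_p)|\,|\mathrm{Jac}(N_q)|=(p^r\pm1)(q^r\pm1)$,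 and $\mathcal K$ can be computed from $p,q,f$. 2. For every admissible $t$ the ideal $(f^2,\ y-tf)$ is invertible, and so defines a class $[t]\in\mathrm{Jac}(N)$; distinct admissible polynomials define distinct classes. 3. Let $1<e<\mathcal K$ with $\gcd(e,\mathcal K)=1$. From $p,q,f,e$ one can compute $d$ with $0\le d<\mathcal K$ and $ed\equiv1\pmod{\mathcal K}$. For every admissible plaintext polynomial $t$, the ciphertext $[t]^e$ is the class of a unique admissible polynomial $g$, one has $([t]^e)^d=[t]$, and $t$ can be computed from $p,q,f,e,g$. In particular, if $t=ax^k+m_kx^{k-1}+\dots+m_2x+m_1$ with $k<r$ carries the message blocks $m_1,\dots,m_k\in\mathbb Z_n$, then the message is recovered as the first $k$ coefficients of $t$. Each of these computations ($\mathcal K$, then $d$, then $t$) is carried out by an explicit algorithm whose number of bit operations (with schoolbook integer arithmetic) is bounded by a polynomial in $r\log n$, uniformly in all the data: the order by Euler's criterion for $x$ in $\mathbb F_p[x]/(f_p)$ and $\mathbb F_q[x]/(f_q)$, the exponent $d$ by the extended Euclidean algorithm, and $t$ by raising $g$ to the power $d$ modulo $p$ and modulo $q$ with the single-polynomial addition law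 $(h_1,h_2)\mapsto (h_1h_2+x)/(h_1+h_2)\bmod f$ of the Jacobian, and the Chinese remainder theorem. -/

import Mathlib

open Polynomial

/-! ### The curve and its Jacobian -/

/-- The coordinate ring `R[x, y] / (y ^ 2 - x f(x) ^ 2)`; the inner polynomial variable is `x` and
the outer one is `y`. -/
abbrev NodalRing {R : Type} [CommRing R] (f : R[X]) : Type :=
  AdjoinRoot (X ^ 2 - C (X * f ^ 2) : R[X][X])

/-- The (generalized) Jacobian of `y ^ 2 = x f(x) ^ 2`: the ideal class group of the coordinate
ring. Over `ℤ/n` the coordinate ring has zero divisors, so the class group is taken in the form of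
the group of invertible modules up to isomorphism (for a domain this is the usual class group, see
`ClassGroup.equivPic`). -/
abbrev NodalJac {R : Type} [CommRing R] (f : R[X]) : Type :=
  CommRing.Pic (NodalRing f)

/-- The ideal `(u, y - v)` with `u = f ^ 2` and `v = t f`, i.e. the divisor `[f ^ 2, t f]`. -/
noncomputable def mumfordIdeal {R : Type} [CommRing R] (f t : R[X]) : Ideal (NodalRing f) :=
  Ideal.span {AdjoinRoot.of _ (f ^ 2), AdjoinRoot.root _ - AdjoinRoot.of _ (t * f)}

/-- `t` is a polynomial with `deg t < deg f` and `gcd (f, x - t ^ 2) = 1`. -/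
def IsJacPoly {R : Type} [CommRing R] (f t : R[X]) : Prop :=
  t.degree < f.degree ∧ IsCoprime f (X - t ^ 2)

/-- The divisor `[f ^ 2, t f]` is invertible and its class is `D`. -/
def Represents {R : Type} [CommRing R] (f t : R[X]) (D : NodalJac f) : Prop :=
  ∃ _ : Module.Invertible (NodalRing f) (mumfordIdeal f t),
    CommRing.Pic.mk (NodalRing f) (mumfordIdeal f t) = D

/-- The homomorphism of coordinate rings induced by a homomorphism of base rings. -/
noncomputable def nodalRingMap {R S : Type} [CommRing R] [CommRing S] (φ : R →+* S) (f : R[X]) :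
    NodalRing f →+* NodalRing (f.map φ) :=
  AdjoinRoot.map (mapRingHom φ) _ _ (by simp)

/-- Base change of divisor classes. -/
noncomputable def nodalJacMap {R S : Type} [CommRing R] [CommRing S] (φ : R →+* S) (f : R[X]) :
    NodalJac f →* NodalJac (f.map φ) :=
  CommRing.Pic.mapRingHom (nodalRingMap φ f)

/-- Reduction `ℤ/pq → ℤ/p`. -/
abbrev redFst (p q : ℕ) : ZMod (p * q) →+* ZMod p := ZMod.castHom (dvd_mul_right p q) (ZMod p)

/-- Reduction `ℤ/pq → ℤ/q`. -/
abbrev redSnd (p q : ℕ) : ZMod (p * q) →+* ZMod q := ZMod.castHom (dvd_mul_left q p) (ZMod q)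

open scoped Classical in
/-- `p ^ r - 1` if `x` is a square in `𝔽_p[x] / (f)`, and `p ^ r + 1` otherwise; `r = deg f`. -/
noncomputable def nodalOrder (p : ℕ) (f : (ZMod p)[X]) : ℕ :=
  if IsSquare (AdjoinRoot.root f) then p ^ f.natDegree - 1 else p ^ f.natDegree + 1

/-- The polynomial `a x ^ k + m_k x ^ (k - 1) + ⋯ + m_2 x + m_1` in which the message blocks
`m_1, …, m_k` are embedded. -/
noncomputable def embedMessage {R : Type} [CommRing R] {k : ℕ} (m : Fin k → R) (a : R) : R[X] :=
  C a * X ^ k + ∑ i : Fin k, C (m i) * X ^ (i : ℕ)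

/-- The list of the coefficients of `1, x, …, x ^ (r - 1)`, as natural numbers less than `n`. -/
def polyCoeffs {n : ℕ} (h : (ZMod n)[X]) (r : ℕ) : List ℕ :=
  (List.range r).map fun i => (h.coeff i).val

/-! ### Computations with a count of bit operations -/

/-- A value together with the number of steps spent to compute it. -/
structure Counted (α : Type) where
  val : α
  cost : ℕ

instance : Monad Counted where
  pure a := ⟨a, 0⟩
  bind x g := ⟨(g x.val).val, x.cost + (g x.val).cost⟩

/-- Spend `k` steps. -/
def tick (k : ℕ) : Counted Unit := ⟨(), k⟩

/-- The cost of one schoolbook operation on `a` and `b`. -/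
def opCost (a b : ℕ) : ℕ := (a.size + 1) * (b.size + 1)

def natAdd (a b : ℕ) : Counted ℕ := ⟨a + b, opCost a b⟩
def natSub (a b : ℕ) : Counted ℕ := ⟨a - b, opCost a b⟩
def natMul (a b : ℕ) : Counted ℕ := ⟨a * b, opCost a b⟩
def natDiv (a b : ℕ) : Counted ℕ := ⟨a / b, opCost a b⟩
def natMod (a b : ℕ) : Counted ℕ := ⟨a % b, opCost a b⟩

/-- Arithmetic modulo `m` on residues `0 ≤ a, b < m`. -/
def modAdd (m a b : ℕ) : Counted ℕ := do
  let s ← natAdd a b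
  natMod s m

def modSub (m a b : ℕ) : Counted ℕ := do
  let s ← natAdd a m
  let s ← natSub s b
  natMod s m

def modMul (m a b : ℕ) : Counted ℕ := do
  let s ← natMul a b
  natMod s m

/-- The extended Euclidean algorithm for `r₀, r₁` with cofactors `s₀, s₁` modulo `m`. -/
def euclid (m r₀ s₀ r₁ s₁ : ℕ) : Counted ℕ :=
  if _h : r₁ = 0 then do
    tick 1
    pure s₀
  else do
    tick (opCost r₀ r₁ + 1)
    let c ← natDiv r₀ r₁
    let c ← natMod c m
    let c ← modMul m c s₁
    let s₂ ← modSub m s₀ c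
    euclid m r₁ s₁ (r₀ % r₁) s₂
termination_by r₁
decreasing_by exact Nat.mod_lt _ (Nat.pos_of_ne_zero _h)

/-- The inverse of `a` modulo `m`. -/
def modInv (m a : ℕ) : Counted ℕ := do
  let b ← natMod a m
  euclid m m 0 b 1

def mapC (g : ℕ → Counted ℕ) : List ℕ → Counted (List ℕ)
  | [] => pure []
  | a :: l => do
    let b ← g a
    let m ← mapC g l
    pure (b :: m)

def zipC (g : ℕ → ℕ → Counted ℕ) : List ℕ → List ℕ → Counted (List ℕ)
  | a :: l, b :: m => do
    let c ← g a b
    let k ← zipC g l m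
    pure (c :: k)
  | _, _ => pure []

/-- Square-and-multiply; the exponent is given by its binary digits, least significant first. -/
def powC {α : Type} (op : α → α → Counted α) (one a : α) : List Bool → Counted α
  | [] => pure one
  | b :: l => do
    tick 1
    let h ← powC op one a l
    let s ← op h h
    if b then op s a else pure s

/-! ### Arithmetic in `𝔽_p[x] / (f)` and in the Jacobian over `𝔽_p`

Residue classes are lists of `r = deg f` coefficients, lowest degree first. The class of `x ^ r` is
kept as the list `w`, which stands for `f` in the procedures below. -/

/-- The class of `x ^ r` modulo `f` and `p`, where `fs` lists the `r + 1` coefficients of `f`. -/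
def reductionRule (p : ℕ) (fs : List ℕ) : Counted (List ℕ) := do
  let fs ← mapC (fun c => natMod c p) fs
  tick fs.length
  let u ← modInv p (fs.getLastD 0)
  mapC (fun c => do
    let v ← modMul p c u
    modSub p 0 v) fs.dropLast

def vecZero (w : List ℕ) : List ℕ := List.replicate w.length 0

def vecOne (w : List ℕ) : List ℕ := 1 :: List.replicate (w.length - 1) 0

def vecAdd (p : ℕ) (a b : List ℕ) : Counted (List ℕ) := zipC (modAdd p) a b

def vecScale (p c : ℕ) (a : List ℕ) : Counted (List ℕ) := mapC (modMul p c) a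

/-- Multiplication by `x`. -/
def vecMulX (p : ℕ) (w a : List ℕ) : Counted (List ℕ) := do
  tick a.length
  let s ← vecScale p (a.getLastD 0) w
  vecAdd p (0 :: a.dropLast) s

/-- Multiplication of `a` by the class with the coefficients in the last argument. -/
def vecMul (p : ℕ) (w a : List ℕ) : List ℕ → Counted (List ℕ)
  | [] => do
    tick w.length
    pure (vecZero w)
  | b :: l => do
    let c ← vecMul p w a l
    let c ← vecMulX p w c
    let s ← vecScale p b a
    vecAdd p c s

/-- Equality test of two residue classes. -/
def vecEq (p : ℕ) (a b : List ℕ) : Counted Bool := do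
  tick ((a.length + b.length + 1) * (p.size + 1))
  pure (decide (a = b))

/-- `p ^ r` with `r = w.length`. -/
def fieldCard (p : ℕ) (w : List ℕ) : Counted ℕ := do
  tick (w.length + 1)
  powC natMul 1 p w.length.bits

/-- The order of the Jacobian over `𝔽_p`, by Euler's criterion for `x` in `𝔽_p[x] / (f)`. -/
def localOrder (p : ℕ) (fs : List ℕ) : Counted ℕ := do
  let w ← reductionRule p fs
  let P ← fieldCard p w
  let P₁ ← natSub P 1
  let h ← natDiv P₁ 2
  let x ← vecMulX p w (vecOne w)
  let s ← powC (vecMul p w) (vecOne w) x h.bits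
  let b ← vecEq p s (vecOne w)
  if b then pure P₁ else natAdd P 1

/-- Addition in the Jacobian over `𝔽_p`, with `none` for the neutral element `[1, 0]` and `some h`
for `[f ^ 2, h f]`: the sum of `h₁` and `h₂` is `none` if `h₁ + h₂ = 0`, and otherwise
`(h₁ h₂ + x) / (h₁ + h₂)` modulo `f`, the inverse being the power with exponent `P - 2`,
`P = p ^ r`. -/
def jacAdd (p : ℕ) (w : List ℕ) (P : ℕ) :
    Option (List ℕ) → Option (List ℕ) → Counted (Option (List ℕ))
  | none, b => do
    tick 1
    pure b
  | some a, none => do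
    tick 1
    pure (some a)
  | some a, some b => do
    let s ← vecAdd p a b
    let z ← vecEq p s (vecZero w)
    if z then pure none
    else do
      let k ← natSub P 2
      let u ← powC (vecMul p w) (vecOne w) s k.bits
      let x ← vecMulX p w (vecOne w)
      let c ← vecMul p w a b
      let c ← vecAdd p c x
      let c ← vecMul p w u c
      pure (some c)

/-- The `d`-th power, in the Jacobian over `𝔽_p`, of the class given by the polynomial `g`. -/
def jacPow (p : ℕ) (fs gs : List ℕ) (d : ℕ) : Counted (Option (List ℕ)) := do
  let w ← reductionRule p fs
  let P ← fieldCard p w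
  let g ← mapC (fun c => natMod c p) gs
  powC (jacAdd p w P) none (some g) d.bits

/-- The residue modulo `p q` that is `a` modulo `p` and `b` modulo `q`, where `v = p⁻¹` modulo
`q`. -/
def crt (p q v a b : ℕ) : Counted ℕ := do
  let c ← natMod a q
  let s ← modSub q b c
  let s ← modMul q s v
  let s ← natMul p s
  natAdd a s

/-! ### Breaking the cryptosystem with the factors of `n`

The inputs are the factors `p, q`, the list `fs` of coefficients of `f`, the encryption exponent `e`
and the list `gs` of coefficients of the ciphertext. -/

/-- The order `K` of the Jacobian over `ℤ/pq`. -/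
def groupOrder (p q : ℕ) (fs : List ℕ) : Counted ℕ := do
  let a ← localOrder p fs
  let b ← localOrder q fs
  natMul a b

/-- The decryption exponent `d = e⁻¹` modulo `K`. -/
def secretExponent (p q : ℕ) (fs : List ℕ) (e : ℕ) : Counted ℕ := do
  let K ← groupOrder p q fs
  modInv K e

/-- Decryption: the `d`-th power of the ciphertext in the Jacobian over `ℤ/pq`, computed modulo `p`
and modulo `q`. -/
def decrypt (p q : ℕ) (fs : List ℕ) (e : ℕ) (gs : List ℕ) : Counted (List ℕ) := do
  let d ← secretExponent p q fs e
  let a ← jacPow p fs gs d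
  let b ← jacPow q fs gs d
  let v ← modInv q p
  match a, b with
  | some s, some t => zipC (crt p q v) s t
  | _, _ => pure []

/-!
Write `A` for the coordinate ring of `y ^ 2 = x f(x) ^ 2`. The substitution `x = z ^ 2`,
`y = z f(z ^ 2)` embeds `A` in `R[z]` (`parametrization_injective`) as the even polynomials plus
the multiples of `f(z ^ 2)`; over a field this is the normalization, and the multiples of `f(z ^ 2)`
form the conductor. A polynomial `w` that is a unit modulo `f(z ^ 2)` gives the `A`-submodule
`glue f w = f(z ^ 2) R[z] + A w` of `R[z]`. These submodules multiply like the polynomials `w`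
(`glue_mul_glue`), hence are invertible, they are compatible with base change
(`nodalJacMap_glueClass`), and multiplication by `f(z ^ 2)` identifies `glue f (z - t)` with the
ideal `(f ^ 2, y - t f)` (`glueEquivMumfordIdeal`).

Let `R` be a field and `f` irreducible. As `R[z]` is a principal ideal domain, Mathlib's exact
sequence of units and Picard groups shows that every class comes from an invertible submodule of
`R[z]`. Such a submodule contains the conductor and has the form `glue f w` (`exists_eq_glue`). The
units of `R[z]` are constants, so distinct submodules have distinct classes
(`unitsToPic_injective`). Writing `w = a + b z` and scaling by residue classes modulo `f` leaves
`w = 1` and `w = z - t` with `t ^ 2 ≠ x` modulo `f`. The order of the Jacobian over a finite field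
is therefore one more than the number of residue classes that are not square roots of `x`
(`card_nodalJac`), and `(z - t) (z - t') = (t t' + x) - (t + t') z` is the addition law
(`jacClass_mul`).

Over `ℤ/pq` the coordinate ring is the product of its reductions. A line bundle on a product is
determined by its restrictions (`pic_prod_injective`), and gluing data modulo `p` and modulo `q`
lift (`nodalJacMap_prod_bijective`). A class that is nontrivial modulo both primes is given by a
unique admissible polynomial, and raising to a power prime to the order of the group preserves this
nontriviality.

The procedures are treated by statements `Spec x c P`, which bound the number of steps of `x` and
describe its value, and which compose along the monad (`Spec.bind`). A residue class is represented
by `residueList`, a divisor class by `jacList`, and each procedure is shown to compute the operation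
on the represented objects. All numbers that occur have fewer than `L = 10 r size(pq)` binary
digits, so that the costs are powers of `L`.
-/

/-! ### Embedding the coordinate ring in the ring of polynomials in `z = √x` -/

section Parametrization

variable {R : Type} [CommRing R]

/-- The parametrization `x = z ^ 2`, `y = z f(z ^ 2)` of the curve. Over a field it is the
inclusion of the coordinate ring in its normalization. -/
noncomputable def parametrization (f : R[X]) : NodalRing f →+* R[X] :=
  AdjoinRoot.lift (expand R 2 : R[X] →+* R[X]) (X * expand R 2 f) (by
    simp [eval₂_sub, eval₂_pow, eval₂_mul]; ring)

@[simp] lemma parametrization_of (f a : R[X]) :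
    parametrization f (AdjoinRoot.of _ a) = expand R 2 a := by
  simp [parametrization]

@[simp] lemma parametrization_root (f : R[X]) :
    parametrization f (AdjoinRoot.root _) = X * expand R 2 f := by
  simp [parametrization]

/-- `R[z]` as an algebra over the coordinate ring of `y ^ 2 = x f(x) ^ 2`. -/
noncomputable instance parametrizationAlgebra (f : R[X]) : Algebra (NodalRing f) R[X] :=
  (parametrization f).toAlgebra

lemma nodal_smul_def (f : R[X]) (a : NodalRing f) (g : R[X]) :
    a • g = parametrization f a * g := rfl

lemma nodal_algebraMap (f : R[X]) : algebraMap (NodalRing f) R[X] = parametrization f := rfl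

/-- Every polynomial in `z` splits into its even and its odd part. -/
lemma exists_even_add_odd (g : R[X]) : ∃ a b : R[X], g = expand R 2 a + X * expand R 2 b := by
  induction g using Polynomial.induction_on' with
  | add p q hp hq =>
    obtain ⟨a, b, rfl⟩ := hp
    obtain ⟨a', b', rfl⟩ := hq
    exact ⟨a + a', b + b', by simp only [map_add]; ring⟩
  | monomial n r =>
    rcases Nat.even_or_odd' n with ⟨k, rfl | rfl⟩
    · exact ⟨monomial k r, 0, by simp [expand_monomial, mul_comm]⟩
    · exact ⟨0, monomial k r, by simp [expand_monomial, X_mul_monomial, mul_comm]⟩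

lemma even_add_odd_eq_zero {a b : R[X]} (h : expand R 2 a + X * expand R 2 b = 0) :
    a = 0 ∧ b = 0 := by
  constructor
  · ext n
    have := congrArg (fun g => coeff g (n * 2)) h
    simp only [coeff_add, coeff_expand_mul (Nat.zero_lt_two), coeff_zero] at this
    rcases n with _ | n
    · simpa using this
    · rw [show (n + 1) * 2 = (n * 2 + 1) + 1 by ring, coeff_X_mul, coeff_expand Nat.zero_lt_two,
        if_neg (by omega), add_zero] at this
      simpa using this
  · ext n
    have := congrArg (fun g => coeff g (n * 2 + 1)) h
    simpa only [coeff_add, coeff_X_mul, coeff_expand_mul (Nat.zero_lt_two), coeff_zero,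
      coeff_expand Nat.zero_lt_two (p := 2) (n := n * 2 + 1),
      if_neg (show ¬ 2 ∣ n * 2 + 1 by omega), zero_add] using this

lemma even_add_odd_inj {a b a' b' : R[X]}
    (h : expand R 2 a + X * expand R 2 b = expand R 2 a' + X * expand R 2 b') :
    a = a' ∧ b = b' := by
  have : expand R 2 (a - a') + X * expand R 2 (b - b') = 0 := by
    simp only [map_sub]; linear_combination h
  simpa [sub_eq_zero] using even_add_odd_eq_zero this

lemma exists_of_add_of_mul_root_of_monic {S : Type*} [CommRing S] [Nontrivial S] {Q : S[X]}
    (hm : Q.Monic) (hQ : Q.natDegree = 2) (α : AdjoinRoot Q) :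
    ∃ a b : S, α = AdjoinRoot.of _ a + AdjoinRoot.of _ b * AdjoinRoot.root _ := by
  obtain ⟨P, rfl⟩ := AdjoinRoot.mk_surjective α
  obtain ⟨a, b, hab⟩ : ∃ a b : S, P %ₘ Q = C b * X + C a := by
    have : (P %ₘ Q).natDegree ≤ 1 := by
      have := natDegree_modByMonic_lt P hm (by rintro rfl; simp at hQ)
      omega
    exact ⟨_, _, eq_X_add_C_of_natDegree_le_one this⟩
  refine ⟨a, b, ?_⟩
  rw [← modByMonic_add_div P Q, hab, map_add, map_mul, AdjoinRoot.mk_self, zero_mul, add_zero,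
    map_add, map_mul, AdjoinRoot.mk_C, AdjoinRoot.mk_C, AdjoinRoot.mk_X, add_comm]

/-- Every element of the coordinate ring is `a(x) + b(x) y`. -/
lemma exists_of_add_of_mul_root (f : R[X]) (α : NodalRing f) :
    ∃ a b : R[X], α = AdjoinRoot.of _ a + AdjoinRoot.of _ b * AdjoinRoot.root _ := by
  cases subsingleton_or_nontrivial R with
  | inl _ => exact ⟨0, 0, (AdjoinRoot.mk_surjective.subsingleton (α := R[X][X])).elim _ _⟩
  | inr _ =>
    exact exists_of_add_of_mul_root_of_monic (monic_X_pow_sub_C _ two_ne_zero)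
      natDegree_X_pow_sub_C α

lemma parametrization_injective {f : R[X]} (hf : IsUnit f.leadingCoeff) :
    Function.Injective (parametrization f) := by
  cases subsingleton_or_nontrivial R with
  | inl _ =>
    have : Subsingleton (NodalRing f) := AdjoinRoot.mk_surjective.subsingleton (α := R[X][X])
    exact Function.injective_of_subsingleton _
  | inr _ => ?_
  rw [injective_iff_map_eq_zero]
  intro α hα
  obtain ⟨a, b, rfl⟩ := exists_of_add_of_mul_root f α
  have : expand R 2 a + X * expand R 2 (b * f) = 0 := by
    rw [← hα]; simp only [map_add, map_mul, parametrization_of, parametrization_root]; ring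
  obtain ⟨rfl, h⟩ := even_add_odd_eq_zero this
  have : b = 0 := by
    by_contra hb
    have := leadingCoeff_mul' (p := b) (q := f) (by
      rw [Ne, hf.mul_left_eq_zero]; simpa using hb)
    rw [h, leadingCoeff_zero, eq_comm, hf.mul_left_eq_zero] at this
    exact hb (by simpa using this)
  simp [this]

lemma mem_range_parametrization (f g : R[X]) : g ∈ Set.range (parametrization f) ↔
    ∃ a h : R[X], g = expand R 2 a + expand R 2 f * h := by
  constructor
  · rintro ⟨α, rfl⟩
    obtain ⟨a, b, rfl⟩ := exists_of_add_of_mul_root f α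
    exact ⟨a, X * expand R 2 b, by simp; ring⟩
  · rintro ⟨a, h, rfl⟩
    obtain ⟨c, d, rfl⟩ := exists_even_add_odd h
    exact ⟨AdjoinRoot.of _ (a + f * c) + AdjoinRoot.of _ d * AdjoinRoot.root _, by simp; ring⟩

end Parametrization

/-! ### The invertible submodules attached to units modulo the conductor -/

section Glue

variable {R : Type} [CommRing R]

/-- The submodule `f R[z] + A w` of `R[z]`, where `A` is the coordinate ring. If `w` is a unit
modulo `f(z ^ 2)`, this is the line bundle obtained from the trivial one on the normalization by
gluing along `w` at the singular points. -/
noncomputable def glue (f w : R[X]) : Submodule (NodalRing f) R[X] where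
  carrier := {g | ∃ h c : R[X], g = expand R 2 f * h + expand R 2 c * w}
  zero_mem' := ⟨0, 0, by simp⟩
  add_mem' := by
    rintro _ _ ⟨h, c, rfl⟩ ⟨h', c', rfl⟩
    exact ⟨h + h', c + c', by simp only [map_add]; ring⟩
  smul_mem' := by
    rintro α _ ⟨h, c, rfl⟩
    obtain ⟨a, b, e⟩ := (mem_range_parametrization f _).1 ⟨α, rfl⟩
    refine ⟨expand R 2 a * h + b * (expand R 2 f * h + expand R 2 c * w), a * c, ?_⟩
    rw [nodal_smul_def, e, map_mul]
    ring

lemma mem_glue {f w g : R[X]} :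
    g ∈ glue f w ↔ ∃ h c : R[X], g = expand R 2 f * h + expand R 2 c * w := Iff.rfl

lemma conductor_mem_glue (f w h : R[X]) : expand R 2 f * h ∈ glue f w := ⟨h, 0, by simp⟩

lemma self_mem_glue (f w : R[X]) : w ∈ glue f w := ⟨0, 1, by simp⟩

/-- `glue f w` is generated by `f(z ^ 2)`, `z f(z ^ 2)` and `w`. -/
lemma glue_le {f w : R[X]} {N : Submodule (NodalRing f) R[X]} (h₁ : expand R 2 f ∈ N)
    (h₂ : X * expand R 2 f ∈ N) (h₃ : w ∈ N) : glue f w ≤ N := by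
  rintro _ ⟨h, c, rfl⟩
  obtain ⟨a, b, rfl⟩ := exists_even_add_odd h
  convert N.add_mem (N.add_mem (N.smul_mem (AdjoinRoot.of _ a) h₁)
    (N.smul_mem (AdjoinRoot.of _ b) h₂)) (N.smul_mem (AdjoinRoot.of _ c) h₃) using 1
  simp only [nodal_smul_def, parametrization_of]
  ring

lemma mem_one_iff {f g : R[X]} : g ∈ (1 : Submodule (NodalRing f) R[X]) ↔
    ∃ a h : R[X], g = expand R 2 a + expand R 2 f * h := by
  rw [← mem_range_parametrization, Submodule.mem_one]
  rfl

lemma glue_one (f : R[X]) : glue f 1 = 1 := by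
  ext g
  rw [mem_glue, mem_one_iff]
  exact ⟨fun ⟨h, c, e⟩ => ⟨c, h, by rw [e]; ring⟩, fun ⟨a, h, e⟩ => ⟨h, a, by rw [e]; ring⟩⟩

lemma glue_le_glue {f w w' c h : R[X]} (e : w = expand R 2 c * w' + expand R 2 f * h) :
    glue f w ≤ glue f w' := by
  rintro _ ⟨h', c', rfl⟩
  exact ⟨h' + expand R 2 c' * h, c' * c, by rw [e, map_mul]; ring⟩

/-- Changing `w` by a unit of `R[x] / (f)` does not change the submodule. -/
lemma glue_eq_glue {f w w' c h : R[X]} (hc : IsCoprime f c)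
    (e : w = expand R 2 c * w' + expand R 2 f * h) : glue f w = glue f w' := by
  refine le_antisymm (glue_le_glue e) ?_
  obtain ⟨u, v, huv⟩ := hc
  have huv' := congrArg (expand R 2) huv
  simp only [map_add, map_mul, map_one] at huv'
  refine glue_le_glue (c := v) (h := expand R 2 u * w' - expand R 2 v * h) ?_
  rw [e]
  linear_combination (-w') * huv'

lemma glue_mul_glue {f w w' : R[X]} (hw : IsCoprime (expand R 2 f) w) :
    glue f w * glue f w' = glue f (w * w') := by
  apply le_antisymm
  · rw [Submodule.mul_le]
    rintro _ ⟨h, c, rfl⟩ _ ⟨h', c', rfl⟩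
    exact ⟨h * (expand R 2 f * h' + expand R 2 c' * w') + expand R 2 c * w * h', c * c',
      by rw [map_mul]; ring⟩
  · obtain ⟨a, b, hab⟩ := hw
    have key : ∀ h, expand R 2 f * h ∈ glue f w * glue f w' := fun h => by
      have h₁ := Submodule.mul_mem_mul (conductor_mem_glue f w (a * h))
        (by simpa using conductor_mem_glue f w' 1)
      have h₂ := Submodule.mul_mem_mul (self_mem_glue f w) (conductor_mem_glue f w' (b * h))
      convert Submodule.add_mem _ h₁ h₂ using 1
      linear_combination (-expand R 2 f * h) * hab
    refine glue_le (by simpa using key 1) (by simpa [mul_comm] using key X) ?_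
    exact Submodule.mul_mem_mul (self_mem_glue f w) (self_mem_glue f w')

lemma isUnit_glue {f w : R[X]} (hw : IsCoprime (expand R 2 f) w) : IsUnit (glue f w) := by
  obtain ⟨a, b, hab⟩ := id hw
  refine IsUnit.of_mul_eq_one (glue f b) ?_
  rw [glue_mul_glue hw, ← glue_one]
  refine glue_eq_glue (c := 1) (h := -a) isCoprime_one_right ?_
  rw [map_one]
  linear_combination hab

instance faithful_of_fact (f : R[X]) [hf : Fact (IsUnit f.leadingCoeff)] :
    FaithfulSMul (NodalRing f) R[X] :=
  (faithfulSMul_iff_algebraMap_injective _ _).2 (parametrization_injective hf.out)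

/-- The class in the Jacobian of the line bundle `glue f w`. -/
noncomputable def glueClass (f : R[X]) [Fact (IsUnit f.leadingCoeff)] (w : R[X])
    (hw : IsCoprime (expand R 2 f) w) : NodalJac f :=
  Submodule.unitsToPic (NodalRing f) R[X] (isUnit_glue hw).unit

lemma glueClass_mul (f : R[X]) [Fact (IsUnit f.leadingCoeff)] {w w' : R[X]}
    (hw : IsCoprime (expand R 2 f) w) (hw' : IsCoprime (expand R 2 f) w') :
    glueClass f w hw * glueClass f w' hw' = glueClass f (w * w') (hw.mul_right hw') := by
  rw [glueClass, glueClass, ← map_mul]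
  congr 1
  exact Units.ext (glue_mul_glue hw)

lemma glueClass_congr (f : R[X]) [Fact (IsUnit f.leadingCoeff)] {w w' : R[X]}
    (hw : IsCoprime (expand R 2 f) w) (hw' : IsCoprime (expand R 2 f) w')
    (h : glue f w = glue f w') : glueClass f w hw = glueClass f w' hw' := by
  rw [glueClass, glueClass]
  congr 1
  exact Units.ext h

lemma glueClass_eq_one (f : R[X]) [Fact (IsUnit f.leadingCoeff)] {w : R[X]}
    (hw : IsCoprime (expand R 2 f) w) (h : glue f w = 1) : glueClass f w hw = 1 := by
  rw [glueClass, ← map_one (Submodule.unitsToPic (NodalRing f) R[X])]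
  congr 1
  exact Units.ext h

lemma IsJacPoly.isCoprime {f t : R[X]} (h : IsJacPoly f t) :
    IsCoprime (expand R 2 f) (X - expand R 2 t) := by
  have := h.2.map (expand R 2 : R[X] →+* R[X])
  simp only [RingHom.coe_coe, map_sub, map_pow, expand_X] at this
  refine IsCoprime.of_mul_right_left (z := X + expand R 2 t) ?_
  convert this using 1
  ring

/-- Multiplication by `f(z ^ 2)` identifies `glue f (z - t)` with the ideal `(f ^ 2, y - t f)`. -/
noncomputable def glueEquivMumfordIdeal (f : R[X]) [hf : Fact (IsUnit f.leadingCoeff)] (t : R[X]) :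
    glue f (X - expand R 2 t) ≃ₗ[NodalRing f] mumfordIdeal f t := by
  have hreg : Function.Injective
      (LinearMap.mulLeft (NodalRing f) (expand R 2 f)) := by
    rw [injective_iff_map_eq_zero]
    intro g hg
    rw [LinearMap.mulLeft_apply] at hg
    by_contra h0
    have hu : IsUnit (expand R 2 f).leadingCoeff := by
      rw [leadingCoeff_expand Nat.zero_lt_two]; exact hf.out
    have := leadingCoeff_mul' (p := expand R 2 f) (q := g) (by
      rw [Ne, hu.mul_right_eq_zero]; simpa using h0)
    rw [hg, leadingCoeff_zero, eq_comm, hu.mul_right_eq_zero] at this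
    exact h0 (by simpa using this)
  have hinj : Function.Injective (Algebra.linearMap (NodalRing f) R[X]) :=
    parametrization_injective hf.out
  refine (Submodule.equivMapOfInjective _ hreg _).trans ((LinearEquiv.ofEq _ _ ?_).trans
    (Submodule.equivMapOfInjective _ hinj (mumfordIdeal f t)).symm)
  rw [mumfordIdeal, Ideal.span, Submodule.map_span, Set.image_pair]
  simp only [Algebra.linearMap_apply, nodal_algebraMap, map_sub, parametrization_of,
    parametrization_root, map_mul, map_pow]
  apply le_antisymm
  · rw [Submodule.map_le_iff_le_comap]
    have h₁ : expand R 2 f ^ 2 ∈ Submodule.span (NodalRing f)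
      {expand R 2 f ^ 2, X * expand R 2 f - expand R 2 t * expand R 2 f} :=
      Submodule.subset_span (by simp)
    have h₂ : X * expand R 2 f - expand R 2 t * expand R 2 f ∈ Submodule.span (NodalRing f)
      {expand R 2 f ^ 2, X * expand R 2 f - expand R 2 t * expand R 2 f} :=
      Submodule.subset_span (by simp)
    apply glue_le
    · simpa only [Submodule.mem_comap, LinearMap.mulLeft_apply, sq] using h₁
    · rw [Submodule.mem_comap, LinearMap.mulLeft_apply]
      convert Submodule.add_mem _ (Submodule.smul_mem _ (AdjoinRoot.of _ t) h₁)
        (Submodule.smul_mem _ (AdjoinRoot.of _ f) h₂) using 1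
      simp only [nodal_smul_def, parametrization_of]
      ring
    · rw [Submodule.mem_comap, LinearMap.mulLeft_apply]
      convert h₂ using 1
      ring
  · rw [Submodule.span_le]
    rintro _ (rfl | rfl)
    · exact ⟨expand R 2 f, by simpa using conductor_mem_glue f _ 1, by simp [sq]⟩
    · exact ⟨_, self_mem_glue f _, by simp; ring⟩

/-- For an admissible `t` the ideal `(f ^ 2, y - t f)` is invertible and its class is that of
`glue f (z - t)`. -/
lemma represents_iff (f : R[X]) [Fact (IsUnit f.leadingCoeff)] {t : R[X]} (h : IsJacPoly f t)
    (D : NodalJac f) : Represents f t D ↔ glueClass f _ h.isCoprime = D := by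
  have e := glueEquivMumfordIdeal f t
  let I := (isUnit_glue h.isCoprime).unit
  have hI : Module.Invertible (NodalRing f) (glue f (X - expand R 2 t)) :=
    inferInstanceAs (Module.Invertible (NodalRing f) I)
  have hM : Module.Invertible (NodalRing f) (mumfordIdeal f t) := .congr e
  have : CommRing.Pic.mk (NodalRing f) (mumfordIdeal f t) = glueClass f _ h.isCoprime :=
    CommRing.Pic.mk_eq_mk_iff.2 ⟨e.symm⟩
  exact ⟨fun ⟨_, h⟩ => this.symm.trans h, fun h => ⟨hM, this.trans h⟩⟩

end Glue

/-! ### Base change -/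

section BaseChange

variable {R S : Type} [CommRing R] [CommRing S]

lemma parametrization_nodalRingMap (φ : R →+* S) (f : R[X]) (α : NodalRing f) :
    parametrization (f.map φ) (nodalRingMap φ f α) = (parametrization f α).map φ := by
  obtain ⟨a, b, rfl⟩ := exists_of_add_of_mul_root f α
  simp [nodalRingMap, map_expand]

lemma map_mem_glue (φ : R →+* S) {f w g : R[X]} (hg : g ∈ glue f w) :
    g.map φ ∈ glue (f.map φ) (w.map φ) := by
  obtain ⟨h, c, rfl⟩ := hg
  exact ⟨h.map φ, c.map φ, by simp [map_expand]⟩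

lemma isCoprime_map_expand (φ : R →+* S) {f w : R[X]} (hw : IsCoprime (expand R 2 f) w) :
    IsCoprime (expand S 2 (f.map φ)) (w.map φ) := by
  simpa [map_expand] using hw.map (mapRingHom φ)

open TensorProduct in
/-- Reducing the class of `glue f w` amounts to reducing `f` and `w`. -/
lemma nodalJacMap_glueClass (φ : R →+* S) (f : R[X]) [Fact (IsUnit f.leadingCoeff)]
    [Fact (IsUnit (f.map φ).leadingCoeff)] {w : R[X]} (hw : IsCoprime (expand R 2 f) w) :
    nodalJacMap φ f (glueClass f w hw) =
      glueClass (f.map φ) (w.map φ) (isCoprime_map_expand φ hw) := by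
  let : Algebra (NodalRing f) (NodalRing (f.map φ)) := (nodalRingMap φ f).toAlgebra
  set I := (isUnit_glue hw).unit
  set J := (isUnit_glue (isCoprime_map_expand φ hw)).unit
  let : Module (NodalRing f) J.1 := Module.compHom _ (nodalRingMap φ f)
  have : IsScalarTower (NodalRing f) (NodalRing (f.map φ)) J.1 :=
    ⟨fun a b c => by
      change (nodalRingMap φ f a * b) • c = nodalRingMap φ f a • b • c
      rw [mul_smul]⟩
  let l : I.1 →ₗ[NodalRing f] J.1 :=
    { toFun := fun g => ⟨g.1.map φ, map_mem_glue φ g.2⟩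
      map_add' := fun a b => Subtype.ext (by simp)
      map_smul' := fun a b => Subtype.ext (by
        change (parametrization f a * b.1).map φ =
          parametrization (f.map φ) (nodalRingMap φ f a) * b.1.map φ
        rw [Polynomial.map_mul, parametrization_nodalRingMap]) }
  let L : NodalRing (f.map φ) ⊗[NodalRing f] I.1 →ₗ[NodalRing (f.map φ)] J.1 :=
    AlgebraTensorModule.lift
      ((LinearMap.ringLmapEquivSelf (NodalRing (f.map φ)) (NodalRing f) _).symm l)
  -- a surjective homomorphism between invertible modules is bijective
  have hL : Function.Surjective L := by
    suffices h : glue (f.map φ) (w.map φ) ≤ (LinearMap.range L).map (Submodule.subtype J.1) by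
      intro j
      obtain ⟨_, ⟨x, rfl⟩, hx⟩ := h j.2
      exact ⟨x, Subtype.ext hx⟩
    have key : ∀ g ∈ glue f w, g.map φ ∈ (LinearMap.range L).map (Submodule.subtype J.1) :=
      fun g hg => ⟨L (1 ⊗ₜ ⟨g, hg⟩), ⟨_, rfl⟩, by simp [L, l]⟩
    refine glue_le ?_ ?_ (key _ (self_mem_glue f w))
    · simpa [map_expand] using key _ (conductor_mem_glue f w 1)
    · simpa [map_expand, mul_comm] using key _ (conductor_mem_glue f w X)
  have hb := Module.Invertible.bijective_of_surjective hL
  have h1 : nodalJacMap φ f (glueClass f w hw) =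
      CommRing.Pic.mk (NodalRing (f.map φ)) (NodalRing (f.map φ) ⊗[NodalRing f] I.1) := by
    change CommRing.Pic.mk _ _ = _
    rw [CommRing.Pic.mk_eq_mk_iff]
    exact ⟨AlgebraTensorModule.congr (.refl ..) (CommRing.Pic.mk.linearEquiv ..)⟩
  rw [h1]
  exact CommRing.Pic.mk_eq_mk_iff.2 ⟨LinearEquiv.ofBijective L hb⟩

end BaseChange

/-! ### The Jacobian over a field -/

section Field

variable {F : Type} [Field F]

instance isUnit_leadingCoeff_of_irreducible (f : F[X]) [hf : Fact (Irreducible f)] :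
    Fact (IsUnit f.leadingCoeff) :=
  ⟨(leadingCoeff_ne_zero.2 hf.out.ne_zero).isUnit⟩

lemma not_isUnit_expand {f : F[X]} (hf : Irreducible f) : ¬ IsUnit (expand F 2 f) := by
  intro h
  have := natDegree_eq_zero_of_isUnit h
  rw [natDegree_expand] at this
  have := hf.natDegree_pos
  omega

lemma one_notMem_conductor {f : F[X]} (hf : Irreducible f) (h : F[X]) : expand F 2 f * h ≠ 1 :=
  fun e => not_isUnit_expand hf (IsUnit.of_mul_eq_one _ e)

/-- An invertible submodule of `F[z]` contains the conductor `f(z ^ 2) F[z]`. -/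
lemma conductor_mem_of_mul_eq_one {f : F[X]} {I J : Submodule (NodalRing f) F[X]} (h : I * J = 1)
    (g : F[X]) : expand F 2 f * g ∈ I := by
  have key : ∀ x ∈ I * J, expand F 2 f * g * x ∈ I := by
    intro x hx
    induction hx using Submodule.mul_induction_on' with
    | mem_mul_mem m hm n hn =>
      obtain ⟨α, hα⟩ := (mem_range_parametrization f (expand F 2 f * (g * n))).2 ⟨0, g * n, by simp⟩
      convert I.smul_mem α hm using 1
      rw [nodal_smul_def, hα]
      ring
    | add x _ y _ hx hy => rw [mul_add]; exact I.add_mem hx hy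
  have h1 : (1 : F[X]) ∈ I * J := h ▸ Submodule.one_le.1 le_rfl
  simpa using key 1 h1

/-- Every invertible submodule of `F[z]` is obtained by gluing. -/
lemma exists_eq_glue {f : F[X]} (hf : Irreducible f) {I J : Submodule (NodalRing f) F[X]}
    (h : I * J = 1) : ∃ w, IsCoprime (expand F 2 f) w ∧ I = glue f w := by
  have hI := conductor_mem_of_mul_eq_one h
  -- `I * J` is not contained in the conductor, so some product of generators is not
  obtain ⟨u, hu, v, hv, huv⟩ : ∃ u ∈ I, ∃ v ∈ J, ¬ expand F 2 f ∣ u * v := by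
    by_contra! H
    have key : ∀ x ∈ I * J, expand F 2 f ∣ x := by
      intro x hx
      induction hx using Submodule.mul_induction_on' with
      | mem_mul_mem m hm n hn => exact H m hm n hn
      | add x _ y _ hx hy => exact dvd_add hx hy
    obtain ⟨g, hg⟩ := key 1 (h ▸ Submodule.one_le.1 le_rfl)
    exact one_notMem_conductor hf g hg.symm
  obtain ⟨c, k, hck⟩ := mem_one_iff.1 (h ▸ Submodule.mul_mem_mul hu hv)
  have hc : ¬ f ∣ c := fun ⟨a, ha⟩ => huv ⟨expand F 2 a + k, by rw [hck, ha, map_mul]; ring⟩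
  obtain ⟨a, b, hab⟩ := (hf.coprime_iff_not_dvd).2 hc
  have hab' := congrArg (expand F 2) hab
  simp only [map_add, map_mul, map_one] at hab'
  refine ⟨u, ⟨expand F 2 a - expand F 2 b * k, expand F 2 b * v, ?_⟩, le_antisymm ?_ ?_⟩
  · linear_combination hab' + expand F 2 b * hck
  · intro x hx
    obtain ⟨d, l, hdl⟩ := mem_one_iff.1 (h ▸ Submodule.mul_mem_mul hx hv)
    refine ⟨expand F 2 a * x - expand F 2 b * k * x + expand F 2 b * l * u, d * b, ?_⟩
    rw [map_mul]
    linear_combination (-x) * hab' + (-expand F 2 b * x) * hck + expand F 2 b * u * hdl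
  · rintro _ ⟨l, d, rfl⟩
    refine I.add_mem (hI l) ?_
    convert I.smul_mem (AdjoinRoot.of _ d) hu using 1
    rw [nodal_smul_def, parametrization_of]

/-- Every class in the Jacobian comes from gluing, because line bundles on the affine line are
trivial. -/
lemma exists_glueClass {f : F[X]} [hf : Fact (Irreducible f)] (D : NodalJac f) :
    ∃ w, ∃ hw : IsCoprime (expand F 2 f) w, glueClass f w hw = D := by
  have : D ∈ (Submodule.unitsToPic (NodalRing f) F[X]).range := by
    rw [Submodule.range_unitsToPic, CommRing.relPic_eq_top]
    exact Subgroup.mem_top D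
  obtain ⟨I, rfl⟩ := this
  obtain ⟨w, hw, e⟩ := exists_eq_glue hf.out I.mul_inv
  refine ⟨w, hw, ?_⟩
  have : (isUnit_glue hw).unit = I := Units.ext e.symm
  rw [glueClass, this]

/-- The units of `F[z]` are constants, so that isomorphic invertible submodules are equal. -/
lemma unitsToPic_injective (f : F[X]) [hf : Fact (Irreducible f)] :
    Function.Injective (Submodule.unitsToPic (NodalRing f) F[X]) := by
  rw [injective_iff_map_eq_one]
  intro I hI
  have : I ∈ (Submodule.unitsToPic (NodalRing f) F[X]).ker := hI
  rw [Submodule.ker_unitsToPic] at this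
  obtain ⟨u, rfl⟩ := this
  obtain ⟨c, hc, hcu⟩ := Polynomial.isUnit_iff.1 u.isUnit
  apply Units.ext
  change Submodule.span (NodalRing f) {u.1} = 1
  apply le_antisymm
  · rw [Submodule.span_singleton_le_iff_mem, mem_one_iff]
    exact ⟨C c, 0, by rw [expand_C, hcu, mul_zero, add_zero]⟩
  · rw [Submodule.one_le, Submodule.mem_span_singleton]
    refine ⟨AdjoinRoot.of _ (C c⁻¹), ?_⟩
    rw [nodal_smul_def, parametrization_of, ← hcu, expand_C, ← C_mul, inv_mul_cancel₀ hc.ne_zero,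
      C_1]

lemma glue_eq_of_glueClass_eq {f : F[X]} [Fact (Irreducible f)] {w w' : F[X]}
    {hw : IsCoprime (expand F 2 f) w} {hw' : IsCoprime (expand F 2 f) w'}
    (h : glueClass f w hw = glueClass f w' hw') : glue f w = glue f w' :=
  congrArg Units.val (unitsToPic_injective f h)

lemma isJacPoly_iff {f t : F[X]} (hf : Irreducible f) :
    IsJacPoly f t ↔ t.degree < f.degree ∧ AdjoinRoot.mk f t ^ 2 ≠ AdjoinRoot.root f := by
  rw [IsJacPoly, hf.coprime_iff_not_dvd, ← AdjoinRoot.mk_eq_zero, map_sub, map_pow,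
    AdjoinRoot.mk_X, sub_eq_zero, ne_comm]

lemma eq_of_mk_eq_of_degree_lt {f t t' : F[X]} (ht : t.degree < f.degree)
    (ht' : t'.degree < f.degree) (h : AdjoinRoot.mk f t = AdjoinRoot.mk f t') : t = t' := by
  rw [← sub_eq_zero]
  exact eq_zero_of_dvd_of_degree_lt (AdjoinRoot.mk_eq_mk.1 h)
    ((degree_sub_le _ _).trans_lt (max_lt ht ht'))

/-- The class `[t]` of an admissible polynomial. -/
noncomputable def jacClass {f : F[X]} [Fact (Irreducible f)] {t : F[X]} (h : IsJacPoly f t) :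
    NodalJac f :=
  glueClass f _ h.isCoprime

lemma jacClass_ne_one {f : F[X]} [hf : Fact (Irreducible f)] {t : F[X]} (h : IsJacPoly f t) :
    jacClass h ≠ 1 := by
  intro e
  have h1 : glueClass f 1 isCoprime_one_right = 1 := glueClass_eq_one f _ (glue_one f)
  have := self_mem_glue f (X - expand F 2 t)
  rw [glue_eq_of_glueClass_eq (e.trans h1.symm), glue_one, mem_one_iff] at this
  obtain ⟨a, g, hg⟩ := this
  obtain ⟨b, c, rfl⟩ := exists_even_add_odd g
  have : expand F 2 (-t) + X * expand F 2 1 =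
      expand F 2 (a + f * b) + X * expand F 2 (f * c) := by
    simp only [map_add, map_mul, map_one, map_neg]; linear_combination hg
  exact hf.out.not_isUnit (IsUnit.of_mul_eq_one _ (even_add_odd_inj this).2.symm)

/-- Distinct admissible polynomials have distinct classes. -/
lemma jacClass_injective {f : F[X]} [hf : Fact (Irreducible f)] {t t' : F[X]} (h : IsJacPoly f t)
    (h' : IsJacPoly f t') (e : jacClass h = jacClass h') : t = t' := by
  have := self_mem_glue f (X - expand F 2 t)
  rw [glue_eq_of_glueClass_eq e] at this
  obtain ⟨g, a, hg⟩ := this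
  obtain ⟨b, c, rfl⟩ := exists_even_add_odd g
  have : expand F 2 (-t) + X * expand F 2 1 =
      expand F 2 (f * b - a * t') + X * expand F 2 (f * c + a) := by
    simp only [map_add, map_mul, map_one, map_neg, map_sub]; linear_combination hg
  obtain ⟨h1, h2⟩ := even_add_odd_inj this
  refine eq_of_mk_eq_of_degree_lt h.1 h'.1 (AdjoinRoot.mk_eq_mk.2 ⟨-(c * t') - b, ?_⟩)
  linear_combination (-h1) - t' * h2

/-- The class of `glue f (a + b z)`: trivial if `b` is zero modulo `f`, and otherwise given by the
polynomial `- a / b` modulo `f`. -/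
lemma glueClass_eq {f : F[X]} [hf : Fact (Irreducible f)] {a b w : F[X]}
    (hw : IsCoprime (expand F 2 f) w) (e : w = expand F 2 a + X * expand F 2 b) :
    if AdjoinRoot.mk f b = 0 then glueClass f w hw = 1
    else ∃ t, ∃ h : IsJacPoly f t, glueClass f w hw = jacClass h ∧
      AdjoinRoot.mk f t = - AdjoinRoot.mk f a / AdjoinRoot.mk f b := by
  split_ifs with hb
  · obtain ⟨c, rfl⟩ := AdjoinRoot.mk_eq_zero.1 hb
    apply glueClass_eq_one
    rw [← glue_one]
    refine glue_eq_glue (c := a) (h := X * expand F 2 c) ?_ (by rw [e, map_mul]; ring)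
    rw [hf.out.coprime_iff_not_dvd]
    rintro ⟨d, rfl⟩
    obtain ⟨u, v, huv⟩ := hw
    refine one_notMem_conductor hf.out (u + v * (expand F 2 d + X * expand F 2 c)) ?_
    rw [e, map_mul, map_mul] at huv
    linear_combination huv
  · obtain ⟨s, hs⟩ := AdjoinRoot.mk_surjective (- AdjoinRoot.mk f a / AdjoinRoot.mk f b)
    have ht : AdjoinRoot.mk f (s % f) = - AdjoinRoot.mk f a / AdjoinRoot.mk f b := by
      rw [← hs, AdjoinRoot.mk_eq_mk]
      exact ⟨-(s / f), by linear_combination EuclideanDomain.mod_add_div s f⟩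
    set t := s % f
    have htd : t.degree < f.degree := degree_mod_lt s hf.out.ne_zero
    obtain ⟨k, hk⟩ : f ∣ a + b * t := by
      rw [← AdjoinRoot.mk_eq_zero, map_add, map_mul, ht]
      rw [mul_div_assoc', mul_div_cancel_left₀ _ hb, add_neg_cancel]
    have hcop : IsCoprime f b := by
      rw [hf.out.coprime_iff_not_dvd, ← AdjoinRoot.mk_eq_zero]; exact hb
    have hwt : w = expand F 2 b * (X - expand F 2 t) + expand F 2 f * expand F 2 k := by
      have := congrArg (expand F 2) hk
      simp only [map_add, map_mul] at this
      rw [e]; linear_combination this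
    have hj : IsJacPoly f t := by
      refine ⟨htd, ?_⟩
      rw [hf.out.coprime_iff_not_dvd]
      rintro ⟨l, hl⟩
      -- the conjugate of `w` is coprime to `f(z ^ 2)` as well, but their product is divisible by it
      have hl' := congrArg (expand F 2) hl
      simp only [map_sub, map_mul, expand_X, map_pow] at hl'
      have hconj : IsCoprime (expand F 2 f) (X + expand F 2 t) := by
        have h1 : IsCoprime (expand F 2 f) (expand F 2 b * (X - expand F 2 t)) := by
          rw [hwt] at hw
          simpa using IsCoprime.of_add_mul_left_right hw
        have h2 := (IsCoprime.of_mul_right_right h1).map (compRingHom (-X))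
        have h3 : ∀ g : F[X], (expand F 2 g).comp (-X) = expand F 2 g := fun g => by
          rw [expand_eq_comp_X_pow, comp_assoc]; simp
        simp only [coe_compRingHom_apply, sub_comp, X_comp, h3] at h2
        rw [show X + expand F 2 t = -(-X - expand F 2 t) by ring]
        exact h2.neg_right
      have h1 : IsCoprime (expand F 2 f) ((X - expand F 2 t) * (X + expand F 2 t)) := by
        refine IsCoprime.mul_right ?_ hconj
        rw [hwt] at hw
        exact IsCoprime.of_mul_right_right (IsCoprime.of_add_mul_left_right hw)
      obtain ⟨u, v, huv⟩ := h1
      refine one_notMem_conductor hf.out (u + v * expand F 2 l) ?_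
      linear_combination huv - v * hl'
    exact ⟨t, hj, glueClass_congr f _ _ (glue_eq_glue hcop hwt), ht⟩

lemma exists_jacClass {f : F[X]} [hf : Fact (Irreducible f)] {D : NodalJac f} (hD : D ≠ 1) :
    ∃ t, ∃ h : IsJacPoly f t, jacClass h = D := by
  obtain ⟨w, hw, rfl⟩ := exists_glueClass D
  obtain ⟨a, b, e⟩ := exists_even_add_odd w
  have := glueClass_eq hw e
  split_ifs at this
  · exact absurd this hD
  · obtain ⟨t, h, e, -⟩ := this
    exact ⟨t, h, e.symm⟩

/-- The addition law of the Jacobian: `(z - t) (z - t') = (t t' + x) - (t + t') z`. -/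
lemma jacClass_mul {f : F[X]} [hf : Fact (Irreducible f)] {t t' : F[X]} (h : IsJacPoly f t)
    (h' : IsJacPoly f t') :
    if AdjoinRoot.mk f t + AdjoinRoot.mk f t' = 0 then jacClass h * jacClass h' = 1
    else ∃ s, ∃ hs : IsJacPoly f s, jacClass h * jacClass h' = jacClass hs ∧
      AdjoinRoot.mk f s = (AdjoinRoot.mk f t * AdjoinRoot.mk f t' + AdjoinRoot.root f) /
        (AdjoinRoot.mk f t + AdjoinRoot.mk f t') := by
  have := glueClass_eq (h.isCoprime.mul_right h'.isCoprime) (a := t * t' + X) (b := -(t + t'))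
    (by simp only [map_add, map_mul, map_neg, expand_X]; ring)
  rw [← glueClass_mul f h.isCoprime h'.isCoprime] at this
  simp only [map_neg, map_add, map_mul, neg_eq_zero, AdjoinRoot.mk_X, neg_div_neg_eq] at this
  exact this

/-- The elements of the Jacobian are the identity and the classes of the admissible polynomials. -/
noncomputable def jacEquiv (f : F[X]) [hf : Fact (Irreducible f)] :
    NodalJac f ≃ Option {h : AdjoinRoot f // h ^ 2 ≠ AdjoinRoot.root f} := by
  classical
  let g : {t // IsJacPoly f t} → {h : AdjoinRoot f // h ^ 2 ≠ AdjoinRoot.root f} :=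
    fun t => ⟨AdjoinRoot.mk f t.1, ((isJacPoly_iff hf.out).1 t.2).2⟩
  have hg : Function.Bijective g := by
    constructor
    · intro t t' e
      exact Subtype.ext (eq_of_mk_eq_of_degree_lt t.2.1 t'.2.1 (congrArg Subtype.val e))
    · rintro ⟨h, hh⟩
      obtain ⟨s, rfl⟩ := AdjoinRoot.mk_surjective h
      have e : AdjoinRoot.mk f (s % f) = AdjoinRoot.mk f s :=
        AdjoinRoot.mk_eq_mk.2 ⟨-(s / f), by linear_combination EuclideanDomain.mod_add_div s f⟩
      exact ⟨⟨s % f, (isJacPoly_iff hf.out).2 ⟨degree_mod_lt s hf.out.ne_zero, by rwa [e]⟩⟩,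
        Subtype.ext e⟩
  let k : Option {t // IsJacPoly f t} → NodalJac f := fun o => o.elim 1 fun t => jacClass t.2
  have hk : Function.Bijective k := by
    constructor
    · rintro (_ | t) (_ | t') e
      · rfl
      · exact absurd e.symm (jacClass_ne_one t'.2)
      · exact absurd e (jacClass_ne_one t.2)
      · exact congrArg some (Subtype.ext (jacClass_injective t.2 t'.2 e))
    · intro D
      by_cases hD : D = 1
      · exact ⟨none, hD.symm⟩
      · obtain ⟨t, h, e⟩ := exists_jacClass hD
        exact ⟨some ⟨t, h⟩, e⟩
  exact (Equiv.ofBijective k hk).symm.trans (Equiv.optionCongr (Equiv.ofBijective g hg))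

end Field

section FiniteField

variable {p : ℕ} [Fact p.Prime]

lemma card_adjoinRoot (f : (ZMod p)[X]) [hf : Fact (Irreducible f)] :
    Nat.card (AdjoinRoot f) = p ^ f.natDegree := by
  have := (AdjoinRoot.powerBasis hf.out.ne_zero).finite
  have := Module.natCard_eq_pow_finrank (K := ZMod p) (V := AdjoinRoot f)
  rw [this, Nat.card_zmod, (AdjoinRoot.powerBasis hf.out.ne_zero).finrank,
    AdjoinRoot.powerBasis_dim]

instance (f : (ZMod p)[X]) [hf : Fact (Irreducible f)] : Finite (AdjoinRoot f) :=
  Nat.finite_of_card_ne_zero (by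
    rw [card_adjoinRoot]; exact pow_ne_zero _ (Fact.out : p.Prime).ne_zero)

lemma root_ne_zero {f : (ZMod p)[X]} [hf : Fact (Irreducible f)] (h0 : f.coeff 0 ≠ 0) :
    AdjoinRoot.root f ≠ 0 := by
  intro h
  rw [← AdjoinRoot.mk_X, AdjoinRoot.mk_eq_zero] at h
  exact h0 (X_dvd_iff.1 ((hf.out.dvd_comm irreducible_X).1 h))

/-- There are `p ^ r` residue classes modulo `f`, of which two or none are square roots of `x`. -/
lemma card_nodalJac (hp : p ≠ 2) (f : (ZMod p)[X]) [hf : Fact (Irreducible f)]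
    (h0 : f.coeff 0 ≠ 0) : Nat.card (NodalJac f) = nodalOrder p f := by
  classical
  rw [Nat.card_congr (jacEquiv f), Finite.card_option]
  have hx := root_ne_zero h0
  have := Fintype.ofFinite (AdjoinRoot f)
  have hc : Nat.card {h : AdjoinRoot f // h ^ 2 ≠ AdjoinRoot.root f} =
      p ^ f.natDegree - Nat.card {h : AdjoinRoot f // h ^ 2 = AdjoinRoot.root f} := by
    rw [← card_adjoinRoot f, Nat.card_eq_fintype_card, Nat.card_eq_fintype_card,
      Nat.card_eq_fintype_card, Fintype.card_subtype_compl]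
  have hpr : 3 ≤ p ^ f.natDegree := by
    have h3 : 3 ≤ p := by have := (Fact.out : p.Prime).two_le; omega
    exact h3.trans (Nat.le_self_pow hf.out.natDegree_pos.ne' p)
  rw [hc, nodalOrder]
  split_ifs with hs
  · obtain ⟨s, hs⟩ := hs
    have hs0 : s ≠ 0 := by rintro rfl; exact hx (by simpa using hs)
    have h2 : (2 : AdjoinRoot f) ≠ 0 := by
      have h2 : (2 : ZMod p) ≠ 0 := by
        intro h
        have := (ZMod.natCast_eq_zero_iff 2 p).1 (by exact_mod_cast h)
        exact hp ((Nat.prime_dvd_prime_iff_eq Fact.out Nat.prime_two).1 this)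
      have := (map_ne_zero (algebraMap (ZMod p) (AdjoinRoot f))).2 h2
      rwa [map_ofNat] at this
    have : Nat.card {h : AdjoinRoot f // h ^ 2 = AdjoinRoot.root f} = 2 := by
      have e : {h : AdjoinRoot f | h ^ 2 = AdjoinRoot.root f} = {s, -s} := by
        ext h
        rw [Set.mem_ofPred_eq, hs, ← sq, sq_eq_sq_iff_eq_or_eq_neg]
        rfl
      change Nat.card ({h : AdjoinRoot f | h ^ 2 = AdjoinRoot.root f} : Set _) = 2
      rw [e, Nat.card_coe_set_eq, Set.ncard_pair]
      intro h
      have : 2 * s = 0 := by linear_combination h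
      exact (mul_eq_zero.1 this).elim h2 hs0
    rw [this]
    omega
  · have : IsEmpty {h : AdjoinRoot f // h ^ 2 = AdjoinRoot.root f} :=
      ⟨fun h => hs ⟨h.1, by rw [← sq, h.2]⟩⟩
    rw [Nat.card_of_isEmpty, Nat.sub_zero]

end FiniteField

/-! ### The Chinese remainder theorem for the Jacobian -/

section Product

open TensorProduct CommRing in
/-- A line bundle on a disjoint union is determined by its restrictions to the two parts. -/
lemma pic_prod_injective {A B C : Type} [CommRing A] [CommRing B] [CommRing C] {φ : A →+* B}
    {ψ : A →+* C} (h : Function.Bijective (φ.prod ψ)) :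
    Function.Injective (fun M : Pic A => (Pic.mapRingHom φ M, Pic.mapRingHom ψ M)) := by
  algebraize [φ, ψ]
  let e : A ≃ₗ[A] B × C := LinearEquiv.ofBijective
    ((Algebra.linearMap A B).prod (Algebra.linearMap A C)) h
  suffices H : ∀ M : Pic A, Pic.mapRingHom φ M = 1 → Pic.mapRingHom ψ M = 1 → M = 1 by
    intro M N hMN
    obtain ⟨h₁, h₂⟩ := Prod.ext_iff.1 hMN
    exact mul_inv_eq_one.1 (H _ (by rw [map_mul, map_inv, mul_inv_eq_one]; exact h₁)
      (by rw [map_mul, map_inv, mul_inv_eq_one]; exact h₂))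
  intro M h₁ h₂
  obtain ⟨e₁⟩ := Pic.mk_eq_one_iff.1 (show Pic.mk B (B ⊗[A] M) = 1 from h₁)
  obtain ⟨e₂⟩ := Pic.mk_eq_one_iff.1 (show Pic.mk C (C ⊗[A] M) = 1 from h₂)
  rw [← Pic.mk_eq_self (M := M), Pic.mk_eq_one_iff]
  exact ⟨(TensorProduct.lid A M).symm ≪≫ₗ (e.rTensor M) ≪≫ₗ TensorProduct.prodLeft A A B C M ≪≫ₗ
    LinearEquiv.prodCongr (e₁.restrictScalars A) (e₂.restrictScalars A) ≪≫ₗ e.symm⟩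

variable {R S T : Type} [CommRing R] [CommRing S] [CommRing T] {φ : R →+* S} {ψ : R →+* T}

/-- The images of a polynomial under `φ` and under `ψ` may be prescribed. -/
lemma exists_map_eq_map_eq (h : Function.Surjective (φ.prod ψ)) (g₁ : S[X]) (g₂ : T[X]) :
    ∃ g : R[X], g.map φ = g₁ ∧ g.map ψ = g₂ := by
  obtain ⟨u, rfl⟩ := map_surjective φ (fun a => (h (a, 0)).imp fun _ hb => congrArg Prod.fst hb) g₁
  obtain ⟨v, rfl⟩ := map_surjective ψ (fun a => (h (0, a)).imp fun _ hb => congrArg Prod.snd hb) g₂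
  obtain ⟨e, he⟩ := h (1, 0)
  have h₁ : φ e = 1 := congrArg Prod.fst he
  have h₂ : ψ e = 0 := congrArg Prod.snd he
  exact ⟨C e * u + C (1 - e) * v, by simp [h₁], by simp [h₂]⟩

lemma eq_of_map_eq_map_eq (h : Function.Injective (φ.prod ψ)) {g g' : R[X]}
    (h₁ : g.map φ = g'.map φ) (h₂ : g.map ψ = g'.map ψ) : g = g' := by
  ext n
  apply h
  have h₁ := congrArg (fun g => coeff g n) h₁
  have h₂ := congrArg (fun g => coeff g n) h₂
  simp only [coeff_map] at h₁ h₂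
  exact Prod.ext h₁ h₂

lemma isCoprime_of_map (h : Function.Bijective (φ.prod ψ)) {a b : R[X]}
    (h₁ : IsCoprime (a.map φ) (b.map φ)) (h₂ : IsCoprime (a.map ψ) (b.map ψ)) : IsCoprime a b := by
  obtain ⟨u₁, v₁, h₁⟩ := h₁
  obtain ⟨u₂, v₂, h₂⟩ := h₂
  obtain ⟨u, hu₁, hu₂⟩ := exists_map_eq_map_eq h.2 u₁ u₂
  obtain ⟨v, hv₁, hv₂⟩ := exists_map_eq_map_eq h.2 v₁ v₂
  exact ⟨u, v, eq_of_map_eq_map_eq h.1 (by simpa [hu₁, hv₁] using h₁)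
    (by simpa [hu₂, hv₂] using h₂)⟩

lemma nodalRingMap_of_add_of_mul_root (φ : R →+* S) (f a b : R[X]) :
    nodalRingMap φ f (AdjoinRoot.of _ a + AdjoinRoot.of _ b * AdjoinRoot.root _) =
      AdjoinRoot.of _ (a.map φ) + AdjoinRoot.of _ (b.map φ) * AdjoinRoot.root _ := by
  simp [nodalRingMap]

lemma nodalRingMap_prod_bijective (h : Function.Bijective (φ.prod ψ)) (f : R[X])
    [hf : Fact (IsUnit f.leadingCoeff)] :
    Function.Bijective ((nodalRingMap φ f).prod (nodalRingMap ψ f)) := by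
  constructor
  · intro α β e
    obtain ⟨e₁, e₂⟩ := Prod.ext_iff.1 e
    replace e₁ : nodalRingMap φ f α = nodalRingMap φ f β := e₁
    replace e₂ : nodalRingMap ψ f α = nodalRingMap ψ f β := e₂
    apply_fun parametrization _ at e₁ e₂
    rw [parametrization_nodalRingMap, parametrization_nodalRingMap] at e₁ e₂
    exact parametrization_injective hf.out (eq_of_map_eq_map_eq h.1 e₁ e₂)
  · rintro ⟨α, β⟩
    obtain ⟨a₁, b₁, rfl⟩ := exists_of_add_of_mul_root _ α
    obtain ⟨a₂, b₂, rfl⟩ := exists_of_add_of_mul_root _ β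
    obtain ⟨a, rfl, rfl⟩ := exists_map_eq_map_eq h.2 a₁ a₂
    obtain ⟨b, rfl, rfl⟩ := exists_map_eq_map_eq h.2 b₁ b₂
    exact ⟨AdjoinRoot.of _ a + AdjoinRoot.of _ b * AdjoinRoot.root _,
      Prod.ext (nodalRingMap_of_add_of_mul_root φ f a b) (nodalRingMap_of_add_of_mul_root ψ f a b)⟩

/-- Surjectivity holds because gluing data over `S` and over `T` lift to gluing data over `R`. -/
lemma nodalJacMap_prod_bijective {S T : Type} [Field S] [Field T] {φ : R →+* S} {ψ : R →+* T}
    (h : Function.Bijective (φ.prod ψ)) (f : R[X])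
    [hf : Fact (IsUnit f.leadingCoeff)] [hfφ : Fact (Irreducible (f.map φ))]
    [hfψ : Fact (Irreducible (f.map ψ))] :
    Function.Bijective (fun D : NodalJac f => (nodalJacMap φ f D, nodalJacMap ψ f D)) := by
  refine ⟨pic_prod_injective (nodalRingMap_prod_bijective h f), ?_⟩
  rintro ⟨D₁, D₂⟩
  obtain ⟨w₁, hw₁, rfl⟩ := exists_glueClass D₁
  obtain ⟨w₂, hw₂, rfl⟩ := exists_glueClass D₂
  obtain ⟨w, rfl, rfl⟩ := exists_map_eq_map_eq h.2 w₁ w₂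
  have hw : IsCoprime (expand R 2 f) w :=
    isCoprime_of_map h (by simpa [map_expand] using hw₁) (by simpa [map_expand] using hw₂)
  exact ⟨glueClass f w hw, Prod.ext (nodalJacMap_glueClass φ f hw) (nodalJacMap_glueClass ψ f hw)⟩

lemma degree_map_of_isUnit_leadingCoeff {S : Type} [CommRing S] [Nontrivial S] (φ : R →+* S)
    {f : R[X]} (hf : IsUnit f.leadingCoeff) : (f.map φ).degree = f.degree :=
  degree_map_eq_of_leadingCoeff_ne_zero φ (hf.map φ).ne_zero

lemma IsJacPoly.map {S : Type} [CommRing S] [Nontrivial S] (φ : R →+* S) {f t : R[X]}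
    (hf : IsUnit f.leadingCoeff) (h : IsJacPoly f t) : IsJacPoly (f.map φ) (t.map φ) := by
  refine ⟨?_, by simpa using h.2.map (mapRingHom φ)⟩
  rw [degree_map_of_isUnit_leadingCoeff φ hf]
  exact degree_map_le.trans_lt h.1

lemma exists_isJacPoly_of_map [Nontrivial S] [Nontrivial T]
    (h : Function.Bijective (φ.prod ψ)) {f : R[X]}
    (hf : IsUnit f.leadingCoeff) {g₁ : S[X]} {g₂ : T[X]} (h₁ : IsJacPoly (f.map φ) g₁)
    (h₂ : IsJacPoly (f.map ψ) g₂) : ∃ g, IsJacPoly f g ∧ g.map φ = g₁ ∧ g.map ψ = g₂ := by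
  obtain ⟨g, rfl, rfl⟩ := exists_map_eq_map_eq h.2 g₁ g₂
  refine ⟨g, ⟨?_, isCoprime_of_map h (by simpa using h₁.2) (by simpa using h₂.2)⟩, rfl, rfl⟩
  have h₁ := h₁.1
  have h₂ := h₂.1
  rw [degree_map_of_isUnit_leadingCoeff _ hf] at h₁ h₂
  have : Nontrivial R := φ.domain_nontrivial
  have hf0 : f ≠ 0 := by rintro rfl; simp at hf
  rw [degree_eq_natDegree hf0, degree_lt_iff_coeff_zero] at h₁ h₂ ⊢
  intro m hm
  refine h.1 (Prod.ext ?_ ?_)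
  · simpa using h₁ m hm
  · simpa using h₂ m hm

lemma nodalJacMap_of_represents {S : Type} [Field S] {φ : R →+* S} {f : R[X]}
    [hf : Fact (IsUnit f.leadingCoeff)] [Fact (Irreducible (f.map φ))] {t : R[X]} {D : NodalJac f}
    (ht : IsJacPoly f t) (h : Represents f t D) :
    nodalJacMap φ f D = jacClass (ht.map φ hf.out) := by
  rw [represents_iff f ht] at h
  rw [← h, nodalJacMap_glueClass, jacClass]
  congr 1
  simp [map_expand]

end Product

lemma zmod_prod_bijective {p q : ℕ} (h : p.Coprime q) :
    Function.Bijective ((redFst p q).prod (redSnd p q)) := by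
  have : (redFst p q).prod (redSnd p q) = (ZMod.chineseRemainder h).toRingHom :=
    RingHom.ext_zmod _ _
  rw [this]
  exact (ZMod.chineseRemainder h).bijective

/-! ### Correctness and cost of the arithmetic procedures -/

section Counted

/-- The procedure `x` spends at most `c` steps and returns a value satisfying `P`. -/
def Spec {α : Type} (x : Counted α) (c : ℕ) (P : α → Prop) : Prop := P x.val ∧ x.cost ≤ c

variable {α β : Type}

lemma Spec.mono {x : Counted α} {c c' : ℕ} {P P' : α → Prop} (h : Spec x c P) (hc : c ≤ c')
    (hP : ∀ a, P a → P' a) : Spec x c' P' :=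
  ⟨hP _ h.1, h.2.trans hc⟩

lemma Spec.mono_cost {x : Counted α} {c c' : ℕ} {P : α → Prop} (h : Spec x c P) (hc : c ≤ c') :
    Spec x c' P :=
  h.mono hc fun _ => id

lemma Spec.pure {a : α} {c : ℕ} {P : α → Prop} (h : P a) : Spec (Pure.pure a : Counted α) c P :=
  ⟨h, Nat.zero_le _⟩

lemma Spec.bind {x : Counted α} {g : α → Counted β} {c c' : ℕ} {P : α → Prop} {Q : β → Prop}
    (h : Spec x c P) (hg : ∀ a, P a → Spec (g a) c' Q) : Spec (x >>= g) (c + c') Q :=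
  ⟨(hg _ h.1).1, Nat.add_le_add h.2 (hg _ h.1).2⟩

lemma Spec.bind_eq {x : Counted α} {g : α → Counted β} {c c' : ℕ} {a : α} {Q : β → Prop}
    (h : Spec x c (· = a)) (hg : Spec (g a) c' Q) : Spec (x >>= g) (c + c') Q :=
  h.bind fun _ hb => hb ▸ hg

lemma tick_spec (k : ℕ) : Spec (tick k) k (· = ()) := ⟨rfl, le_rfl⟩

/-! ### Operations on natural numbers -/

variable {L : ℕ}

lemma size_lt_of_le {a m : ℕ} (h : a ≤ m) (hm : m.size < L) : a.size < L :=
  (Nat.size_le_size h).trans_lt hm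

lemma size_mul_le (a b : ℕ) : (a * b).size ≤ a.size + b.size := by
  rw [Nat.size_le, pow_add]
  exact Nat.mul_lt_mul'' (Nat.lt_size_self a) (Nat.lt_size_self b)

lemma size_add_le {a b m : ℕ} (ha : a ≤ m) (hb : b ≤ m) : (a + b).size ≤ m.size + 1 := by
  rw [Nat.size_le, pow_succ]
  have := Nat.lt_size_self m
  omega

lemma size_pow_le (a n : ℕ) : (a ^ n).size ≤ n * a.size + 1 := by
  induction n with
  | zero => simp
  | succ n ih =>
    rw [pow_succ, add_mul, one_mul]
    have := size_mul_le (a ^ n) a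
    omega

lemma opCost_le {a b : ℕ} (ha : a.size < L) (hb : b.size < L) : opCost a b ≤ L ^ 2 := by
  rw [sq]
  exact Nat.mul_le_mul ha hb

lemma natAdd_spec {a b : ℕ} (ha : a.size < L) (hb : b.size < L) :
    Spec (natAdd a b) (L ^ 2) (· = a + b) := ⟨rfl, opCost_le ha hb⟩

lemma natSub_spec {a b : ℕ} (ha : a.size < L) (hb : b.size < L) :
    Spec (natSub a b) (L ^ 2) (· = a - b) := ⟨rfl, opCost_le ha hb⟩

lemma natMul_spec {a b : ℕ} (ha : a.size < L) (hb : b.size < L) :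
    Spec (natMul a b) (L ^ 2) (· = a * b) := ⟨rfl, opCost_le ha hb⟩

lemma natDiv_spec {a b : ℕ} (ha : a.size < L) (hb : b.size < L) :
    Spec (natDiv a b) (L ^ 2) (· = a / b) := ⟨rfl, opCost_le ha hb⟩

lemma natMod_spec {a b : ℕ} (ha : a.size < L) (hb : b.size < L) :
    Spec (natMod a b) (L ^ 2) (· = a % b) := ⟨rfl, opCost_le ha hb⟩

variable {m : ℕ}

/-! The hypothesis `2 * m.size + 2 ≤ L` leaves room for a product of two residues modulo `m`. -/

lemma modAdd_spec (hm : 2 * m.size + 2 ≤ L) {a b : ℕ} (ha : a ≤ m) (hb : b ≤ m) :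
    Spec (modAdd m a b) (2 * L ^ 2) (· = (a + b) % m) := by
  have hmL : m.size < L := by omega
  rw [two_mul]
  refine (natAdd_spec (size_lt_of_le ha hmL) (size_lt_of_le hb hmL)).bind_eq (natMod_spec ?_ hmL)
  have := size_add_le ha hb
  omega

lemma modSub_spec (hm : 2 * m.size + 2 ≤ L) {a b : ℕ} (ha : a ≤ m) (hb : b ≤ m) :
    Spec (modSub m a b) (3 * L ^ 2) (· = (a + m - b) % m) := by
  have hmL : m.size < L := by omega
  have h1 : (a + m).size < L := by
    have := size_add_le ha le_rfl
    omega
  rw [show 3 * L ^ 2 = L ^ 2 + (L ^ 2 + L ^ 2) by ring]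
  refine (natAdd_spec (size_lt_of_le ha hmL) hmL).bind_eq
    ((natSub_spec h1 (size_lt_of_le hb hmL)).bind_eq (natMod_spec ?_ hmL))
  exact size_lt_of_le (Nat.sub_le _ _) h1

lemma modMul_spec (hm : 2 * m.size + 2 ≤ L) {a b : ℕ} (ha : a ≤ m) (hb : b ≤ m) :
    Spec (modMul m a b) (2 * L ^ 2) (· = (a * b) % m) := by
  have hmL : m.size < L := by omega
  rw [two_mul]
  refine (natMul_spec (size_lt_of_le ha hmL) (size_lt_of_le hb hmL)).bind_eq (natMod_spec ?_ hmL)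
  have h1 := size_mul_le a b
  have h2 := Nat.size_le_size ha
  have h3 := Nat.size_le_size hb
  omega

lemma cast_modSub (a : ℕ) {b : ℕ} (hb : b ≤ m) : (((a + m - b) % m : ℕ) : ZMod m) = a - b := by
  rw [ZMod.natCast_mod, Nat.cast_sub (by omega)]
  simp

/-- The remainders decrease so fast that `r₀ r₁` is halved in each round, which bounds the number
of rounds. The cofactors satisfy `sᵢ a ≡ rᵢ` throughout. -/
lemma euclid_spec (hL : 9 ≤ L) (hm : 2 * m.size + 2 ≤ L) (hm0 : 0 < m) {a : ZMod m} (k : ℕ) :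
    ∀ r₀ s₀ r₁ s₁ : ℕ, 0 < r₀ → r₁ ≤ r₀ → r₀ ≤ m → s₀ < m → s₁ < m → (s₀ : ZMod m) * a = r₀ →
      (s₁ : ZMod m) * a = r₁ → r₀ * r₁ < 2 ^ k →
      Spec (euclid m r₀ s₀ r₁ s₁) (k * (L ^ 3 + 1) + 1)
        (fun s => s < m ∧ (s : ZMod m) * a = (r₀.gcd r₁ : ℕ)) := by
  have hmL : m.size < L := by omega
  induction k with
  | zero =>
    intro r₀ s₀ r₁ s₁ h0 _ _ hs₀ _ e₀ _ hk
    obtain rfl : r₁ = 0 := by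
      rcases Nat.mul_eq_zero.1 (Nat.lt_one_iff.1 hk) with h | h <;> omega
    rw [euclid, dif_pos rfl]
    refine Spec.mono_cost (c := 1 + 0) ((tick_spec 1).bind_eq (Spec.pure ?_)) (by omega)
    exact ⟨hs₀, by simpa using e₀⟩
  | succ k ih =>
    intro r₀ s₀ r₁ s₁ h0 h10 h0m hs₀ hs₁ e₀ e₁ hk
    rw [euclid]
    split_ifs with h
    · subst h
      refine Spec.mono_cost (c := 1 + 0) ((tick_spec 1).bind_eq (Spec.pure ?_)) (by omega)
      exact ⟨hs₀, by simpa using e₀⟩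
    · have hr₀ := size_lt_of_le h0m hmL
      have hr₁ := size_lt_of_le (h10.trans h0m) hmL
      have hq : (r₀ / r₁ % m) ≤ m := (Nat.mod_lt _ hm0).le
      have hc : (r₀ / r₁ % m * s₁) % m ≤ m := (Nat.mod_lt _ hm0).le
      have hlt : r₀ % r₁ < r₁ := Nat.mod_lt _ (Nat.pos_of_ne_zero h)
      have hdm := Nat.div_add_mod r₀ r₁
      have hhalf : r₁ * (r₀ % r₁) < 2 ^ k := by
        have : 1 ≤ r₀ / r₁ := (Nat.one_le_div_iff (Nat.pos_of_ne_zero h)).2 h10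
        have : 2 * (r₀ % r₁) ≤ r₀ := by nlinarith
        have : r₁ * (2 * (r₀ % r₁)) ≤ r₁ * r₀ := Nat.mul_le_mul_left _ this
        rw [pow_succ] at hk
        linarith
      have ih := ih r₁ s₁ (r₀ % r₁) ((s₀ + m - (r₀ / r₁ % m * s₁) % m) % m)
        (Nat.pos_of_ne_zero h) hlt.le (h10.trans h0m) hs₁ (Nat.mod_lt _ hm0) e₁ (by
          rw [cast_modSub _ hc, ZMod.natCast_mod, Nat.cast_mul, ZMod.natCast_mod, sub_mul, e₀,
            mul_assoc, e₁]
          have := congrArg (Nat.cast (R := ZMod m)) hdm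
          push_cast at this
          linear_combination -this) hhalf
      have hgcd : r₁.gcd (r₀ % r₁) = r₀.gcd r₁ := by
        rw [Nat.gcd_comm r₀ r₁, Nat.gcd_rec r₁ r₀, Nat.gcd_comm]
      rw [hgcd] at ih
      have h9 : 9 * L ^ 2 ≤ L ^ 3 := by rw [pow_succ L 2, mul_comm]; exact Nat.mul_le_mul_left _ hL
      refine Spec.mono_cost ((tick_spec _).bind_eq ((natDiv_spec hr₀ hr₁).bind_eq
        ((natMod_spec (size_lt_of_le (Nat.div_le_self _ _) hr₀) hmL).bind_eq
        ((modMul_spec hm hq hs₁.le).bind_eq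
        ((modSub_spec hm hs₀.le hc).bind_eq ih))))) ?_
      have := opCost_le hr₀ hr₁
      have : (k + 1) * (L ^ 3 + 1) = k * (L ^ 3 + 1) + L ^ 3 + 1 := by ring
      omega

lemma modInv_spec (hL : 9 ≤ L) (hm : 2 * m.size + 2 ≤ L) (hm1 : 1 < m) {a : ℕ} (ha : a.size < L)
    (h : a.Coprime m) :
    Spec (modInv m a) (L ^ 5) (fun s => s < m ∧ (s : ZMod m) * a = 1) := by
  have hb : a % m < m := Nat.mod_lt _ (by omega)
  have hk : m * (a % m) < 2 ^ (m.size + m.size) := by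
    rw [pow_add]
    exact Nat.mul_lt_mul'' (Nat.lt_size_self m) (hb.trans (Nat.lt_size_self m))
  have key := (natMod_spec ha (by omega : m.size < L)).bind_eq
    (g := fun b => euclid m m 0 b 1) (euclid_spec hL hm (by omega) (a := (a : ZMod m)) _ m 0
      (a % m) 1 (by omega) hb.le le_rfl
      (by omega) hm1 (by simp) (by simp) hk)
  have hg : m.gcd (a % m) = 1 := by rw [Nat.gcd_comm, ← Nat.gcd_rec, Nat.gcd_comm]; exact h
  rw [hg, Nat.cast_one] at key
  refine key.mono_cost ?_
  have h1 : (m.size + m.size) * (L ^ 3 + 1) ≤ (L - 2) * (L ^ 3 + 1) :=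
    Nat.mul_le_mul_right _ (by omega)
  have h2 : (L - 2) * (L ^ 3 + 1) ≤ L * (L ^ 3 + 1) := Nat.mul_le_mul_right _ (by omega)
  have h3 : L * (L ^ 3 + 1) = L ^ 4 + L := by ring
  have h5 : L ^ 5 = L * L ^ 4 := by ring
  have h6 : 9 * L ^ 4 ≤ L * L ^ 4 := Nat.mul_le_mul_right _ hL
  have h7 : L ≤ L ^ 4 := Nat.le_self_pow (by omega) L
  have h8 : L ^ 2 ≤ L ^ 4 := Nat.pow_le_pow_right (by omega) (by omega)
  omega

/-! ### Lists and powers -/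

lemma mapC_spec {g : ℕ → Counted ℕ} {h : ℕ → ℕ} {c : ℕ} {l : List ℕ}
    (H : ∀ a ∈ l, Spec (g a) c (· = h a)) : Spec (mapC g l) (l.length * c) (· = l.map h) := by
  induction l with
  | nil => exact Spec.pure rfl
  | cons a l ih =>
    rw [List.length_cons, show (l.length + 1) * c = c + (l.length * c + 0) by ring]
    exact (H a (by simp)).bind_eq ((ih fun b hb => H b (by simp [hb])).bind_eq (Spec.pure rfl))

lemma zipC_spec {g : ℕ → ℕ → Counted ℕ} {h : ℕ → ℕ → ℕ} {c : ℕ} {l m : List ℕ}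
    (H : ∀ a ∈ l, ∀ b ∈ m, Spec (g a b) c (· = h a b)) :
    Spec (zipC g l m) (l.length * c) (· = List.zipWith h l m) := by
  induction l generalizing m with
  | nil => exact Spec.pure rfl
  | cons a l ih =>
    cases m with
    | nil => exact Spec.pure rfl
    | cons b m =>
      rw [List.length_cons, show (l.length + 1) * c = c + (l.length * c + 0) by ring]
      refine (H a (by simp) b (by simp)).bind_eq ((ih fun a ha b hb => ?_).bind_eq (Spec.pure rfl))
      exact H a (by simp [ha]) b (by simp [hb])

/-- The number with the given binary digits, least significant first. -/
def ofBits : List Bool → ℕ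
  | [] => 0
  | b :: l => b.toNat + 2 * ofBits l

lemma ofBits_bits (n : ℕ) : ofBits n.bits = n := by
  induction n using Nat.binaryRec' with
  | zero => simp [ofBits]
  | bit b n h ih =>
    rw [Nat.bits_append_bit n b h, ofBits, ih, Nat.bit_val]
    cases b <;> simp [add_comm]

/-- Square-and-multiply, where `P i` says that the argument is the `i`-th power; the intermediate
exponents never exceed the final one. -/
lemma powC_spec {op : α → α → Counted α} {one a : α} {c N : ℕ} {P : ℕ → α → Prop} (h0 : P 0 one)
    (h1 : P 1 a)
    (hop : ∀ i j x y, P i x → P j y → i + j ≤ N → Spec (op x y) c (P (i + j))) (l : List Bool)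
    (hl : ofBits l ≤ N) : Spec (powC op one a l) (l.length * (2 * c + 1)) (P (ofBits l)) := by
  induction l with
  | nil => exact Spec.pure h0
  | cons b l ih =>
    rw [ofBits] at hl ⊢
    refine ((tick_spec 1).bind_eq ((ih (by omega)).bind fun h hh =>
      (hop _ _ h h hh hh (by omega)).bind (c' := c) fun s hs => ?_)).mono_cost ?_
    · cases b
      · exact Spec.pure (by simpa [two_mul] using hs)
      · have := hop _ _ s a hs h1 (by simp at hl; omega)
        simpa [two_mul, add_comm] using this
    · rw [List.length_cons, add_mul, one_mul]
      omega

end Counted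

/-! ### Residue classes as lists of coefficients -/

section Lists

variable {n : ℕ}

lemma length_polyCoeffs (h : (ZMod n)[X]) (r : ℕ) : (polyCoeffs h r).length = r := by
  simp [polyCoeffs]

lemma getElem_polyCoeffs (h : (ZMod n)[X]) {r i : ℕ} (hi : i < (polyCoeffs h r).length) :
    (polyCoeffs h r)[i] = (h.coeff i).val := by
  simp [polyCoeffs]

lemma lt_of_mem_polyCoeffs [NeZero n] {h : (ZMod n)[X]} {r a : ℕ} (ha : a ∈ polyCoeffs h r) :
    a < n := by
  obtain ⟨i, -, rfl⟩ := List.mem_map.1 ha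
  exact ZMod.val_lt _

lemma polyCoeffs_congr {h h' : (ZMod n)[X]} {r : ℕ} (H : ∀ i < r, h.coeff i = h'.coeff i) :
    polyCoeffs h r = polyCoeffs h' r :=
  List.map_congr_left fun i hi => by rw [H i (List.mem_range.1 hi)]

lemma coeff_eq_of_polyCoeffs_eq [NeZero n] {h h' : (ZMod n)[X]} {r : ℕ}
    (H : polyCoeffs h r = polyCoeffs h' r) (i : ℕ) (hi : i < r) : h.coeff i = h'.coeff i :=
  ZMod.val_injective n (List.map_inj_left.1 H i (List.mem_range.2 hi))

lemma zipWith_polyCoeffs {m k : ℕ} {F : ℕ → ℕ → ℕ} {h : (ZMod n)[X]} {h' : (ZMod m)[X]}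
    {h'' : (ZMod k)[X]} {r : ℕ}
    (H : ∀ i < r, F (h.coeff i).val (h'.coeff i).val = (h''.coeff i).val) :
    List.zipWith F (polyCoeffs h r) (polyCoeffs h' r) = polyCoeffs h'' r := by
  refine List.ext_getElem (by simp [length_polyCoeffs]) fun i hi _ => ?_
  rw [List.getElem_zipWith, getElem_polyCoeffs, getElem_polyCoeffs, getElem_polyCoeffs]
  rw [List.length_zipWith, length_polyCoeffs, length_polyCoeffs, min_self] at hi
  exact H i hi

lemma map_polyCoeffs {m : ℕ} {F : ℕ → ℕ} {h : (ZMod n)[X]} {h' : (ZMod m)[X]} {r : ℕ}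
    (H : ∀ i < r, F (h.coeff i).val = (h'.coeff i).val) :
    (polyCoeffs h r).map F = polyCoeffs h' r := by
  rw [polyCoeffs, polyCoeffs, List.map_map]
  exact List.map_congr_left fun i hi => H i (List.mem_range.1 hi)

lemma dropLast_range (r : ℕ) : (List.range (r + 1)).dropLast = List.range r := by
  simp [List.range_succ]

lemma cons_dropLast_polyCoeffs (h : (ZMod n)[X]) (r : ℕ) :
    0 :: (polyCoeffs h (r + 1)).dropLast = polyCoeffs (X * h) (r + 1) := by
  rw [polyCoeffs, polyCoeffs, ← List.map_dropLast, dropLast_range,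
    List.range_succ_eq_map]
  simp [Function.comp_def, coeff_X_mul]

lemma dropLast_polyCoeffs (h : (ZMod n)[X]) (r : ℕ) :
    (polyCoeffs h (r + 1)).dropLast = polyCoeffs h r := by
  rw [polyCoeffs, polyCoeffs, ← List.map_dropLast, dropLast_range]

lemma getLastD_polyCoeffs (h : (ZMod n)[X]) (r : ℕ) :
    (polyCoeffs h (r + 1)).getLastD 0 = (h.coeff r).val := by
  rw [polyCoeffs, List.range_succ, List.map_append]
  simp

lemma polyCoeffs_map_redFst {p q : ℕ} [NeZero (p * q)] [NeZero p] (h : (ZMod (p * q))[X]) (r : ℕ) :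
    (polyCoeffs h r).map (· % p) = polyCoeffs (h.map (redFst p q)) r := by
  refine map_polyCoeffs fun i _ => ?_
  rw [coeff_map, ← ZMod.val_natCast]
  congr 1
  simp [redFst, ZMod.natCast_val]

lemma polyCoeffs_map_redSnd {p q : ℕ} [NeZero (p * q)] [NeZero q] (h : (ZMod (p * q))[X]) (r : ℕ) :
    (polyCoeffs h r).map (· % q) = polyCoeffs (h.map (redSnd p q)) r := by
  refine map_polyCoeffs fun i _ => ?_
  rw [coeff_map, ← ZMod.val_natCast]
  congr 1
  simp [redSnd, ZMod.natCast_val]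

end Lists

section Residues

variable {p : ℕ} [hpp : Fact p.Prime] {g : (ZMod p)[X]} [hg : Fact (Irreducible g)]

lemma exists_reduced (k : AdjoinRoot g) : ∃ a, a.degree < g.degree ∧ AdjoinRoot.mk g a = k := by
  obtain ⟨a, rfl⟩ := AdjoinRoot.mk_surjective k
  exact ⟨a % g, degree_mod_lt a hg.out.ne_zero,
    AdjoinRoot.mk_eq_mk.2 ⟨-(a / g), by linear_combination EuclideanDomain.mod_add_div a g⟩⟩

/-- The list of coefficients of the reduced polynomial in a residue class modulo `g`. -/
noncomputable def residueList (k : AdjoinRoot g) : List ℕ :=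
  polyCoeffs (exists_reduced k).choose g.natDegree

lemma residueList_mk {a : (ZMod p)[X]} (ha : a.degree < g.degree) :
    residueList (AdjoinRoot.mk g a) = polyCoeffs a g.natDegree := by
  have := (exists_reduced (AdjoinRoot.mk g a)).choose_spec
  rw [residueList, eq_of_mk_eq_of_degree_lt this.1 ha this.2]

lemma length_residueList (k : AdjoinRoot g) : (residueList k).length = g.natDegree :=
  length_polyCoeffs _ _

lemma degree_lt_of_coeff {a : (ZMod p)[X]} (h : ∀ i, g.natDegree ≤ i → a.coeff i = 0) :
    a.degree < g.degree := by
  rw [degree_eq_natDegree hg.out.ne_zero, degree_lt_iff_coeff_zero]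
  exact h

lemma coeff_eq_zero_of_degree_lt {a : (ZMod p)[X]} (h : a.degree < g.degree) {i : ℕ}
    (hi : g.natDegree ≤ i) : a.coeff i = 0 := by
  rw [degree_eq_natDegree hg.out.ne_zero, degree_lt_iff_coeff_zero] at h
  exact h i hi

lemma residueList_injective : Function.Injective (residueList (g := g)) := by
  intro k k' h
  obtain ⟨a, ha, rfl⟩ := exists_reduced k
  obtain ⟨b, hb, rfl⟩ := exists_reduced k'
  rw [residueList_mk ha, residueList_mk hb] at h
  congr 1
  ext i
  rcases lt_or_ge i g.natDegree with hi | hi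
  · exact coeff_eq_of_polyCoeffs_eq h i hi
  · rw [coeff_eq_zero_of_degree_lt ha hi, coeff_eq_zero_of_degree_lt hb hi]

lemma vecZero_eq {w : List ℕ} (hw : w.length = g.natDegree) :
    vecZero w = residueList (0 : AdjoinRoot g) := by
  rw [← map_zero (AdjoinRoot.mk g), residueList_mk (degree_lt_of_coeff (by simp)), vecZero, hw,
    polyCoeffs]
  simp

lemma vecOne_eq {w : List ℕ} (hw : w.length = g.natDegree) :
    vecOne w = residueList (1 : AdjoinRoot g) := by
  have hr := hg.out.natDegree_pos
  rw [← map_one (AdjoinRoot.mk g), residueList_mk (degree_lt_of_coeff (fun i hi => by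
    rw [coeff_one, if_neg (by omega)])), vecOne, hw, polyCoeffs]
  obtain ⟨r, e⟩ := Nat.exists_eq_succ_of_ne_zero hr.ne'
  rw [e, List.range_succ_eq_map]
  simp [Function.comp_def, coeff_one, ZMod.val_one p]

end Residues

/-! ### Arithmetic in `𝔽_p[x] / (f)` -/

section FieldArithmetic

/-- The bounds that keep every intermediate number below `2 ^ L`: there is room for products of
residues modulo `p` and for the order `p ^ r` of the residue field. -/
structure Bounds (p r L : ℕ) : Prop where
  large : 40 ≤ L
  size : 2 * p.size + 2 ≤ L
  degree : r + 1 ≤ L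
  card : (p ^ r).size + 2 ≤ L

/-- A power of `L` absorbs a sum of up to forty lower ones; this is how costs are added up. -/
lemma mul_pow_le {L i j : ℕ} (hL : 40 ≤ L) (h : i < j) : 40 * L ^ i ≤ L ^ j :=
  calc 40 * L ^ i ≤ L * L ^ i := Nat.mul_le_mul_right _ hL
    _ = L ^ (i + 1) := by ring
    _ ≤ L ^ j := Nat.pow_le_pow_right (by omega) h

lemma mul_self_le {L j : ℕ} (hL : 40 ≤ L) (h : 1 < j) : 40 * L ≤ L ^ j := by
  simpa using mul_pow_le hL h

lemma fieldCard_spec {p : ℕ} [hpp : Fact p.Prime] {L r : ℕ} (hB : Bounds p r L) {w : List ℕ}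
    (hw : w.length = r) :
    Spec (fieldCard p w) (L ^ 5) (· = p ^ r) := by
  unfold fieldCard
  rw [hw]
  have := powC_spec (op := natMul) (one := 1) (a := p) (P := fun i x => x = p ^ i)
    (N := r) (c := L ^ 2) (by rw [pow_zero]) (by rw [pow_one]) (by
      rintro i j _ _ rfl rfl hij
      rw [pow_add]
      have := hB.card
      exact natMul_spec
        (size_lt_of_le (Nat.pow_le_pow_right hpp.out.pos (by omega : i ≤ r)) (by omega))
        (size_lt_of_le (Nat.pow_le_pow_right hpp.out.pos (by omega : j ≤ r)) (by omega)))
    _ (ofBits_bits r).le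
  rw [ofBits_bits, Nat.size_eq_bits_len] at this
  refine Spec.mono_cost ((tick_spec _).bind_eq this) ?_
  have h0 := hB.degree
  have h5 : r.size ≤ r := Nat.size_le.2 Nat.lt_two_pow_self
  have h1 : r.size * (2 * L ^ 2 + 1) ≤ L * (2 * L ^ 2 + 1) :=
    Nat.mul_le_mul_right _ (by omega)
  have h2 : L * (2 * L ^ 2 + 1) = 2 * L ^ 3 + L := by ring
  have h3 := mul_pow_le hB.large (show 3 < 5 by omega)
  have h4 := mul_self_le hB.large (show 1 < 5 by omega)
  omega

variable {p : ℕ} [hpp : Fact p.Prime] {g : (ZMod p)[X]} [hg : Fact (Irreducible g)] {L : ℕ}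

lemma cast_sub_mod {m n : ℕ} (a : ZMod m) (h : n ≤ m) [NeZero m] (e : (n : ZMod m) = -a) :
    (0 + m - n) % m = a.val := by
  rw [← ZMod.val_natCast, Nat.cast_sub (by omega), e]
  simp

/-- `reductionRule` computes the class of `x ^ r`. -/
lemma reductionRule_spec (hB : Bounds p g.natDegree L) {fs : List ℕ}
    (hfs : fs.map (· % p) = polyCoeffs g (g.natDegree + 1)) (hsize : ∀ a ∈ fs, a.size < L) :
    Spec (reductionRule p fs) (L ^ 6) (· = residueList (AdjoinRoot.root g ^ g.natDegree)) := by
  set r := g.natDegree with hr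
  have hpL : p.size < L := by have := hB.size; omega
  have hlen : fs.length = r + 1 := by
    rw [← List.length_map (· % p), hfs, length_polyCoeffs]
  have hlc : g.coeff r ≠ 0 := leadingCoeff_ne_zero.2 hg.out.ne_zero
  have hcop : (g.coeff r).val.Coprime p := by
    rw [Nat.coprime_comm, hpp.out.coprime_iff_not_dvd]
    intro h
    rw [← ZMod.natCast_eq_zero_iff, ZMod.natCast_zmod_val] at h
    exact hlc h
  have hroot : AdjoinRoot.root g ^ r = AdjoinRoot.mk g (X ^ r - C (g.coeff r)⁻¹ * g) := by
    rw [map_sub, map_mul, AdjoinRoot.mk_self, mul_zero, sub_zero, map_pow, AdjoinRoot.mk_X]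
  have hdeg : (X ^ r - C (g.coeff r)⁻¹ * g).degree < g.degree := by
    refine degree_lt_of_coeff fun i hi => ?_
    rw [coeff_sub, coeff_C_mul, coeff_X_pow]
    rcases hi.eq_or_lt with rfl | hi
    · rw [← hr]; simp [hlc]
    · rw [coeff_eq_zero_of_natDegree_lt hi, if_neg (by omega)]
      simp
  unfold reductionRule
  refine Spec.mono_cost ((mapC_spec (h := (· % p)) fun a ha =>
    natMod_spec (hsize a ha) hpL).bind_eq ((tick_spec _).bind_eq ((modInv_spec
      (by have := hB.large; omega) hB.size hpp.out.one_lt ?_ ?_).bind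
      (c' := r * (5 * L ^ 2)) fun u hu => ?_))) ?_
  · rw [hfs, getLastD_polyCoeffs]
    exact size_lt_of_le (ZMod.val_lt _).le hpL
  · rw [hfs, getLastD_polyCoeffs]
    exact hcop
  · rw [hfs, getLastD_polyCoeffs, ZMod.natCast_zmod_val] at hu
    have hu' : (u : ZMod p) = (g.coeff r)⁻¹ := eq_inv_of_mul_eq_one_left hu.2
    rw [hfs, dropLast_polyCoeffs, hroot, residueList_mk hdeg]
    have := mapC_spec (l := polyCoeffs g r) (c := 5 * L ^ 2)
      (g := fun c => do
        let v ← modMul p c u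
        modSub p 0 v) (h := fun c => (0 + p - c * u % p) % p) fun c hc => by
          rw [show 5 * L ^ 2 = 2 * L ^ 2 + 3 * L ^ 2 by ring]
          exact (modMul_spec hB.size (lt_of_mem_polyCoeffs hc).le hu.1.le).bind_eq
            (modSub_spec hB.size (Nat.zero_le _) (Nat.mod_lt _ hpp.out.pos).le)
    rw [length_polyCoeffs, map_polyCoeffs (h' := X ^ r - C (g.coeff r)⁻¹ * g) fun i hi => by
      refine cast_sub_mod _ (Nat.mod_lt _ hpp.out.pos).le ?_
      rw [ZMod.natCast_mod, Nat.cast_mul, ZMod.natCast_zmod_val, hu', coeff_sub, coeff_C_mul,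
        coeff_X_pow, if_neg hi.ne]
      ring] at this
    exact this
  · rw [hfs, length_polyCoeffs, hlen]
    have h1 := hB.degree
    have h2 : (r + 1) * L ^ 2 ≤ L * L ^ 2 := Nat.mul_le_mul_right _ h1
    have h3 : r * (5 * L ^ 2) ≤ L * (5 * L ^ 2) := Nat.mul_le_mul_right _ (by omega)
    have h4 := mul_pow_le hB.large (show 3 < 5 by omega)
    have h5 := mul_self_le hB.large (show 1 < 5 by omega)
    have h6 := mul_pow_le hB.large (show 5 < 6 by omega)
    have h7 : L * L ^ 2 = L ^ 3 := by ring
    have h8 : L * (5 * L ^ 2) = 5 * L ^ 3 := by ring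
    omega

lemma vecAdd_spec (hB : Bounds p g.natDegree L) (k k' : AdjoinRoot g) :
    Spec (vecAdd p (residueList k) (residueList k')) (2 * L ^ 3) (· = residueList (k + k')) := by
  obtain ⟨a, ha, rfl⟩ := exists_reduced k
  obtain ⟨b, hb, rfl⟩ := exists_reduced k'
  have := zipC_spec (l := polyCoeffs a g.natDegree) (m := polyCoeffs b g.natDegree) fun x hx y hy =>
    modAdd_spec hB.size (lt_of_mem_polyCoeffs hx).le (lt_of_mem_polyCoeffs hy).le
  rw [zipWith_polyCoeffs (h'' := a + b) fun i _ => by rw [coeff_add, ZMod.val_add],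
    length_polyCoeffs] at this
  rw [← map_add, residueList_mk ha, residueList_mk hb,
    residueList_mk ((degree_add_le _ _).trans_lt (max_lt ha hb))]
  refine this.mono_cost ?_
  calc g.natDegree * (2 * L ^ 2) ≤ L * (2 * L ^ 2) :=
        Nat.mul_le_mul_right _ (by have := hB.degree; omega)
    _ = _ := by ring

lemma vecScale_spec (hB : Bounds p g.natDegree L) (c : ZMod p) (k : AdjoinRoot g) :
    Spec (vecScale p c.val (residueList k)) (2 * L ^ 3)
      (· = residueList (AdjoinRoot.of g c * k)) := by
  obtain ⟨a, ha, rfl⟩ := exists_reduced k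
  have := mapC_spec (l := polyCoeffs a g.natDegree) fun x hx =>
    modMul_spec hB.size (ZMod.val_lt c).le (lt_of_mem_polyCoeffs hx).le
  rw [map_polyCoeffs (h' := C c * a) fun i _ => by rw [coeff_C_mul, ZMod.val_mul],
    length_polyCoeffs] at this
  rw [← AdjoinRoot.mk_C, ← map_mul, residueList_mk ha,
    residueList_mk (degree_lt_of_coeff fun i hi => by
      rw [coeff_C_mul, coeff_eq_zero_of_degree_lt ha hi, mul_zero])]
  refine this.mono_cost ?_
  calc g.natDegree * (2 * L ^ 2) ≤ L * (2 * L ^ 2) :=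
        Nat.mul_le_mul_right _ (by have := hB.degree; omega)
    _ = _ := by ring

lemma vecMulX_spec (hB : Bounds p g.natDegree L) (k : AdjoinRoot g) :
    Spec (vecMulX p (residueList (AdjoinRoot.root g ^ g.natDegree)) (residueList k)) (L ^ 4)
      (· = residueList (AdjoinRoot.root g * k)) := by
  obtain ⟨W, hW, eW⟩ := exists_reduced (AdjoinRoot.root g ^ g.natDegree)
  obtain ⟨a, ha, rfl⟩ := exists_reduced k
  obtain ⟨s, hs⟩ := Nat.exists_eq_succ_of_ne_zero hg.out.natDegree_pos.ne'
  rw [Nat.succ_eq_add_one] at hs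
  -- the coefficients of degree less than `r` of `x a` are those of `x a - a_s x ^ r`
  have hd : (X * a - C (a.coeff s) * X ^ (s + 1)).degree < g.degree := by
    refine degree_lt_of_coeff fun i hi => ?_
    obtain ⟨j, rfl⟩ := Nat.exists_eq_succ_of_ne_zero (show i ≠ 0 by omega)
    rw [coeff_sub, Nat.succ_eq_add_one, coeff_X_mul, coeff_C_mul, coeff_X_pow]
    by_cases hj : j = s
    · subst hj; simp
    · rw [if_neg (by omega), coeff_eq_zero_of_degree_lt ha (by omega)]
      simp
  have e1 : 0 :: (residueList (AdjoinRoot.mk g a)).dropLast =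
      residueList (AdjoinRoot.mk g (X * a - C (a.coeff s) * X ^ (s + 1))) := by
    rw [residueList_mk ha, residueList_mk hd, hs, cons_dropLast_polyCoeffs]
    refine polyCoeffs_congr fun i hi => ?_
    rw [coeff_sub, coeff_C_mul, coeff_X_pow, if_neg (by omega)]
    simp
  have e2 : (residueList (AdjoinRoot.mk g a)).getLastD 0 = (a.coeff s).val := by
    rw [residueList_mk ha, hs, getLastD_polyCoeffs]
  have e3 : AdjoinRoot.root g * AdjoinRoot.mk g a =
      AdjoinRoot.mk g (X * a - C (a.coeff s) * X ^ (s + 1)) +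
        AdjoinRoot.of g (a.coeff s) * AdjoinRoot.root g ^ g.natDegree := by
    rw [map_sub, map_mul, map_mul, map_pow, AdjoinRoot.mk_X, AdjoinRoot.mk_C, hs]
    ring
  unfold vecMulX
  rw [e1, e2, e3]
  refine Spec.mono_cost ((tick_spec _).bind_eq ((vecScale_spec hB _ _).bind_eq
    (vecAdd_spec hB _ _))) ?_
  rw [length_residueList]
  have h1 := hB.degree
  have h2 := mul_pow_le hB.large (show 3 < 4 by omega)
  have h3 := mul_self_le hB.large (show 1 < 4 by omega)
  omega

/-- The recursion of `vecMul` is Horner's scheme for the second factor. -/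
lemma vecMul_aux_spec (hB : Bounds p g.natDegree L) (k : AdjoinRoot g) (l : List (ZMod p)) :
    Spec (vecMul p (residueList (AdjoinRoot.root g ^ g.natDegree)) (residueList k)
      (l.map ZMod.val)) (l.length * (2 * L ^ 4) + L)
      (· = residueList (k * l.foldr (fun b s => AdjoinRoot.of g b + AdjoinRoot.root g * s) 0)) := by
  induction l with
  | nil =>
    rw [List.foldr_nil, mul_zero, ← vecZero_eq (length_residueList _)]
    refine Spec.mono_cost ((tick_spec _).bind_eq (c' := 0) (Spec.pure rfl)) ?_
    rw [length_residueList]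
    have := hB.degree
    simp
    omega
  | cons b l ih =>
    rw [List.map_cons, List.foldr_cons]
    generalize l.foldr (fun b s => AdjoinRoot.of g b + AdjoinRoot.root g * s) 0 = s at ih ⊢
    rw [show k * (AdjoinRoot.of g b + AdjoinRoot.root g * s) =
      AdjoinRoot.root g * (k * s) + AdjoinRoot.of g b * k by ring]
    refine Spec.mono_cost (ih.bind_eq ((vecMulX_spec hB _).bind_eq ((vecScale_spec hB b k).bind_eq
      (vecAdd_spec hB _ _)))) ?_
    rw [List.length_cons, add_mul]
    have h2 := mul_pow_le hB.large (show 3 < 4 by omega)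
    omega

/-- Every residue class is the value at `x` of its list of coefficients. -/
lemma exists_list_foldr (k : AdjoinRoot g) : ∃ l : List (ZMod p), residueList k = l.map ZMod.val ∧
    l.foldr (fun b s => AdjoinRoot.of g b + AdjoinRoot.root g * s) 0 = k := by
  obtain ⟨a, ha, rfl⟩ := exists_reduced k
  refine ⟨(List.range g.natDegree).map a.coeff, ?_, ?_⟩
  · rw [residueList_mk ha, polyCoeffs, List.map_map]
    rfl
  · have key : ∀ r, ∀ a : (ZMod p)[X], ((List.range r).map a.coeff).foldr
        (fun b s => AdjoinRoot.of g b + AdjoinRoot.root g * s) 0 =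
        AdjoinRoot.mk g (∑ i ∈ Finset.range r, C (a.coeff i) * X ^ i) := by
      intro r
      induction r with
      | zero => simp
      | succ r ih =>
        intro a
        have := ih a.divX
        rw [List.range_succ_eq_map, List.map_cons, List.foldr_cons, List.map_map]
        rw [show a.coeff ∘ Nat.succ = a.divX.coeff by ext; simp [coeff_divX], this,
          Finset.sum_range_succ', ← AdjoinRoot.mk_C, ← AdjoinRoot.mk_X, ← map_mul, ← map_add,
          Finset.mul_sum]
        congr 1
        rw [add_comm, pow_zero, mul_one]
        congr 1
        exact Finset.sum_congr rfl fun i _ => by rw [coeff_divX]; ring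
    have hlt : a.natDegree < g.natDegree := by
      rcases eq_or_ne a 0 with rfl | h
      · simpa using hg.out.natDegree_pos
      · exact natDegree_lt_natDegree h ha
    rw [key, ← as_sum_range_C_mul_X_pow' a hlt]

lemma vecMul_spec (hB : Bounds p g.natDegree L) (k k' : AdjoinRoot g) :
    Spec (vecMul p (residueList (AdjoinRoot.root g ^ g.natDegree)) (residueList k)
      (residueList k')) (L ^ 6) (· = residueList (k * k')) := by
  obtain ⟨l, hl, e⟩ := exists_list_foldr k'
  have := vecMul_aux_spec hB k l
  rw [e, ← hl] at this
  refine this.mono_cost ?_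
  rw [← List.length_map (as := l) ZMod.val, ← hl, length_residueList]
  have h1 : g.natDegree * (2 * L ^ 4) ≤ L * (2 * L ^ 4) :=
    Nat.mul_le_mul_right _ (by have := hB.degree; omega)
  have h2 : L * (2 * L ^ 4) = 2 * L ^ 5 := by ring
  have h3 := mul_pow_le hB.large (show 5 < 6 by omega)
  have h4 := mul_self_le hB.large (show 1 < 6 by omega)
  omega

lemma vecPow_spec (hB : Bounds p g.natDegree L) (k : AdjoinRoot g) {n : ℕ} (hn : n.size < L) :
    Spec (powC (vecMul p (residueList (AdjoinRoot.root g ^ g.natDegree)))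
      (residueList (1 : AdjoinRoot g)) (residueList k) n.bits) (L ^ 8)
      (· = residueList (k ^ n)) := by
  have := powC_spec (op := vecMul p (residueList (AdjoinRoot.root g ^ g.natDegree)))
    (one := residueList (1 : AdjoinRoot g)) (a := residueList k)
    (P := fun i x => x = residueList (k ^ i)) (N := n) (c := L ^ 6) (by rw [pow_zero])
    (by rw [pow_one]) (by
      rintro i j _ _ rfl rfl -
      rw [pow_add]
      exact vecMul_spec hB _ _) n.bits (ofBits_bits n).le
  rw [ofBits_bits, Nat.size_eq_bits_len] at this
  refine this.mono_cost ?_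
  have h1 : n.size * (2 * L ^ 6 + 1) ≤ L * (2 * L ^ 6 + 1) := Nat.mul_le_mul_right _ hn.le
  have h2 : L * (2 * L ^ 6 + 1) = 2 * L ^ 7 + L := by ring
  have h3 := mul_pow_le hB.large (show 7 < 8 by omega)
  have h4 := mul_self_le hB.large (show 1 < 8 by omega)
  omega

lemma vecEq_spec (hB : Bounds p g.natDegree L) (k k' : AdjoinRoot g) :
    Spec (vecEq p (residueList k) (residueList k')) (L ^ 3) (· = decide (k = k')) := by
  refine Spec.mono_cost ((tick_spec _).bind_eq (c' := 0) (Spec.pure ?_)) ?_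
  · rw [decide_eq_decide]
    exact residueList_injective.eq_iff
  · rw [length_residueList, length_residueList]
    have h1 : (g.natDegree + g.natDegree + 1) * (p.size + 1) ≤ (2 * L) * L :=
      Nat.mul_le_mul (by have := hB.degree; omega) (by have := hB.size; omega)
    have h2 : 2 * L * L = 2 * L ^ 2 := by ring
    have h3 := mul_pow_le hB.large (show 2 < 3 by omega)
    omega

/-- Euler's criterion decides whether the singular point is a split node. -/
lemma localOrder_spec (hB : Bounds p g.natDegree L) (hp2 : p ≠ 2) (h0 : g.coeff 0 ≠ 0)
    {fs : List ℕ} (hfs : fs.map (· % p) = polyCoeffs g (g.natDegree + 1))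
    (hsize : ∀ a ∈ fs, a.size < L) : Spec (localOrder p fs) (L ^ 9) (· = nodalOrder p g) := by
  have hlen := length_residueList (AdjoinRoot.root g ^ g.natDegree)
  have hP : (p ^ g.natDegree).size < L := by have := hB.card; omega
  have hP1 : (p ^ g.natDegree - 1).size < L := size_lt_of_le (Nat.sub_le _ _) hP
  have hodd : Odd (p ^ g.natDegree) := (hpp.out.odd_of_ne_two hp2).pow
  have hS1 : (1 : ℕ).size < L := by rw [Nat.size_one]; have := hB.large; omega
  have hS2 : (2 : ℕ).size < L := by
    have := hB.large
    have : (2 : ℕ).size ≤ 2 := Nat.size_le.2 (by norm_num)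
    omega
  have hsq : IsSquare (AdjoinRoot.root g) ↔
      AdjoinRoot.root g ^ ((p ^ g.natDegree - 1) / 2) = 1 := by
    have := Fintype.ofFinite (AdjoinRoot g)
    rw [FiniteField.isSquare_iff _ (root_ne_zero h0), ← Nat.card_eq_fintype_card, card_adjoinRoot]
    · obtain ⟨m, hm⟩ := hodd
      rw [hm, show (2 * m + 1) / 2 = m by omega, show (2 * m + 1 - 1) / 2 = m by omega]
    · have : CharP (AdjoinRoot g) p := charP_of_injective_algebraMap
        (algebraMap (ZMod p) (AdjoinRoot g)).injective p
      rwa [ringChar.eq (AdjoinRoot g) p]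
  have hfin : Spec (if decide (AdjoinRoot.root g ^ ((p ^ g.natDegree - 1) / 2) = 1) = true then
      pure (p ^ g.natDegree - 1) else natAdd (p ^ g.natDegree) 1) (L ^ 2)
      (· = nodalOrder p g) := by
    rw [nodalOrder]
    by_cases h : IsSquare (AdjoinRoot.root g)
    · rw [if_pos h, if_pos (by simpa using hsq.1 h)]
      exact Spec.pure rfl
    · rw [if_neg h, if_neg (by simpa using mt hsq.2 h)]
      exact natAdd_spec hP hS1
  unfold localOrder
  refine Spec.mono_cost ((reductionRule_spec hB hfs hsize).bind_eq
    ((fieldCard_spec hB hlen).bind_eq ((natSub_spec hP hS1).bind_eq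
    ((natDiv_spec hP1 hS2).bind_eq (c' := L ^ 4 + (L ^ 8 + (L ^ 3 + L ^ 2))) ?_)))) ?_
  · rw [vecOne_eq hlen]
    have := vecMulX_spec hB (1 : AdjoinRoot g)
    rw [mul_one] at this
    exact this.bind_eq ((vecPow_spec hB _ (size_lt_of_le (Nat.div_le_self _ _) hP1)).bind_eq
      ((vecEq_spec hB _ _).bind_eq hfin))
  · have h2 := mul_pow_le hB.large (show 2 < 9 by omega)
    have h3 := mul_pow_le hB.large (show 3 < 9 by omega)
    have h4 := mul_pow_le hB.large (show 4 < 9 by omega)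
    have h5 := mul_pow_le hB.large (show 5 < 9 by omega)
    have h6 := mul_pow_le hB.large (show 6 < 9 by omega)
    have h8 := mul_pow_le hB.large (show 8 < 9 by omega)
    omega

end FieldArithmetic

/-! ### Arithmetic in the Jacobian over `𝔽_p` -/

section JacArithmetic

variable {p : ℕ} [hpp : Fact p.Prime] {g : (ZMod p)[X]} [hg : Fact (Irreducible g)] {L : ℕ}

open scoped Classical in
/-- The representation of divisor classes used by the procedures. -/
noncomputable def jacList (D : NodalJac g) : Option (List ℕ) :=
  if h : D = 1 then none else some (polyCoeffs (exists_jacClass h).choose g.natDegree)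

lemma jacList_one : jacList (1 : NodalJac g) = none := dif_pos rfl

lemma jacList_jacClass {t : (ZMod p)[X]} (h : IsJacPoly g t) :
    jacList (jacClass h) = some (polyCoeffs t g.natDegree) := by
  rw [jacList, dif_neg (jacClass_ne_one h)]
  obtain ⟨h', e⟩ := (exists_jacClass (jacClass_ne_one h)).choose_spec
  rw [jacClass_injective h' h e]

lemma jacList_jacClass' {t : (ZMod p)[X]} (h : IsJacPoly g t) :
    jacList (jacClass h) = some (residueList (AdjoinRoot.mk g t)) := by
  rw [jacList_jacClass, residueList_mk h.1]

/-- The procedure implements the addition law `jacClass_mul`. -/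
lemma jacAdd_spec (hB : Bounds p g.natDegree L) (D D' : NodalJac g) :
    Spec (jacAdd p (residueList (AdjoinRoot.root g ^ g.natDegree)) (p ^ g.natDegree)
      (jacList D) (jacList D')) (L ^ 9) (· = jacList (D * D')) := by
  have hlen := length_residueList (AdjoinRoot.root g ^ g.natDegree)
  have h9 : 1 ≤ L ^ 9 := Nat.one_le_pow _ _ (by have := hB.large; omega)
  by_cases hD : D = 1
  · subst hD
    rw [one_mul, jacList_one, jacAdd]
    exact Spec.mono_cost (c := 1 + 0) ((tick_spec 1).bind_eq (Spec.pure rfl)) h9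
  obtain ⟨t, ht, rfl⟩ := exists_jacClass hD
  by_cases hD' : D' = 1
  · subst hD'
    rw [mul_one, jacList_one, jacList_jacClass', jacAdd]
    exact Spec.mono_cost (c := 1 + 0) ((tick_spec 1).bind_eq (Spec.pure rfl)) h9
  obtain ⟨t', ht', rfl⟩ := exists_jacClass hD'
  rw [jacList_jacClass' ht, jacList_jacClass' ht', jacAdd, vecZero_eq hlen, vecOne_eq hlen]
  set k := AdjoinRoot.mk g t
  set k' := AdjoinRoot.mk g t'
  have h2 := mul_pow_le hB.large (show 2 < 9 by omega)
  have h3 := mul_pow_le hB.large (show 3 < 9 by omega)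
  have h4 := mul_pow_le hB.large (show 4 < 9 by omega)
  have h6 := mul_pow_le hB.large (show 6 < 9 by omega)
  have h8 := mul_pow_le hB.large (show 8 < 9 by omega)
  refine Spec.mono_cost ((vecAdd_spec hB k k').bind_eq ((vecEq_spec hB _ _).bind_eq
    (c' := L ^ 2 + (L ^ 8 + (L ^ 4 + (L ^ 6 + (2 * L ^ 3 + (L ^ 6 + 0)))))) ?_)) (by omega)
  have hmul := jacClass_mul ht ht'
  split_ifs at hmul with h
  · rw [if_pos (by simpa using h), hmul, jacList_one]
    exact Spec.pure rfl
  · obtain ⟨s, hs, e, hsk⟩ := hmul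
    rw [if_neg (by simpa using h), e, jacList_jacClass' hs, hsk]
    have hP : (p ^ g.natDegree).size < L := by have := hB.card; omega
    have hS2 : (2 : ℕ).size < L := by
      have := hB.large
      have : (2 : ℕ).size ≤ 2 := Nat.size_le.2 (by norm_num)
      omega
    have hx := vecMulX_spec hB (1 : AdjoinRoot g)
    rw [mul_one] at hx
    -- the inverse is a power, by Fermat's little theorem in the residue field
    have hinv : (k + k') ^ (p ^ g.natDegree - 2) = (k + k')⁻¹ := by
      have := Fintype.ofFinite (AdjoinRoot g)
      refine eq_inv_of_mul_eq_one_left ?_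
      have hc := FiniteField.pow_card_sub_one_eq_one (k + k') h
      rw [← Nat.card_eq_fintype_card, card_adjoinRoot] at hc
      have h2 : 2 ≤ p ^ g.natDegree :=
        hpp.out.two_le.trans (Nat.le_self_pow hg.out.natDegree_pos.ne' p)
      rw [← pow_succ, show p ^ g.natDegree - 2 + 1 = p ^ g.natDegree - 1 by omega, hc]
    rw [div_eq_inv_mul, ← hinv]
    exact (natSub_spec hP hS2).bind_eq
      ((vecPow_spec hB _ (size_lt_of_le (Nat.sub_le _ _) hP)).bind_eq (hx.bind_eq
      ((vecMul_spec hB k k').bind_eq ((vecAdd_spec hB _ _).bind_eq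
      ((vecMul_spec hB _ _).bind_eq (Spec.pure rfl))))))

lemma jacPow_spec (hB : Bounds p g.natDegree L) {fs gs : List ℕ}
    (hfs : fs.map (· % p) = polyCoeffs g (g.natDegree + 1)) (hsize : ∀ a ∈ fs, a.size < L)
    {t : (ZMod p)[X]} (ht : IsJacPoly g t) (hgs : gs.map (· % p) = polyCoeffs t g.natDegree)
    (hsize' : ∀ a ∈ gs, a.size < L) {d : ℕ} (hd : d.size < L) :
    Spec (jacPow p fs gs d) (L ^ 11) (· = jacList (jacClass ht ^ d)) := by
  have hlen := length_residueList (AdjoinRoot.root g ^ g.natDegree)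
  have hpL : p.size < L := by have := hB.size; omega
  have hpow := powC_spec (op := jacAdd p (residueList (AdjoinRoot.root g ^ g.natDegree))
    (p ^ g.natDegree)) (one := none) (a := some (gs.map (· % p)))
    (P := fun i x => x = jacList (jacClass ht ^ i)) (N := d) (c := L ^ 9)
    (by rw [pow_zero, jacList_one]) (by rw [pow_one, jacList_jacClass, hgs]) (by
      rintro i j _ _ rfl rfl -
      rw [pow_add]
      exact jacAdd_spec hB _ _) d.bits (ofBits_bits d).le
  rw [ofBits_bits, Nat.size_eq_bits_len] at hpow
  unfold jacPow
  refine Spec.mono_cost ((reductionRule_spec hB hfs hsize).bind_eq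
    ((fieldCard_spec hB hlen).bind_eq ((mapC_spec (h := (· % p)) fun a ha =>
      natMod_spec (hsize' a ha) hpL).bind_eq hpow))) ?_
  have hgl : gs.length = g.natDegree := by rw [← List.length_map (· % p), hgs, length_polyCoeffs]
  rw [hgl]
  have h0 := hB.degree
  have h1 : d.size * (2 * L ^ 9 + 1) ≤ L * (2 * L ^ 9 + 1) := Nat.mul_le_mul_right _ hd.le
  have h2 : L * (2 * L ^ 9 + 1) = 2 * L ^ 10 + L := by ring
  have h3 : g.natDegree * L ^ 2 ≤ L * L ^ 2 := Nat.mul_le_mul_right _ (by omega)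
  have h4 : L * L ^ 2 = L ^ 3 := by ring
  have h5 := mul_pow_le hB.large (show 10 < 11 by omega)
  have h6 := mul_self_le hB.large (show 1 < 11 by omega)
  have h7 := mul_pow_le hB.large (show 3 < 11 by omega)
  have h8 := mul_pow_le hB.large (show 5 < 11 by omega)
  have h9 := mul_pow_le hB.large (show 6 < 11 by omega)
  omega

end JacArithmetic

/-! ### Decryption -/

section Decryption

lemma crt_spec {p q : ℕ} [Fact p.Prime] [Fact q.Prime] {L : ℕ} (hL : 40 ≤ L)
    (hp : 2 * p.size + 2 ≤ L) (hq : 2 * q.size + 2 ≤ L) (hpq : (p * q).size < L) {v a b : ℕ}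
    (hv : v < q) (ha : a < p) (hb : b < q) :
    Spec (crt p q v a b) (L ^ 3) (· = a + p * ((b + q - a % q) % q * v % q)) := by
  have hq0 : 0 < q := (Fact.out : q.Prime).pos
  have hpL : p.size < L := by omega
  have hqL : q.size < L := by omega
  have h1 : (b + q - a % q) % q * v % q < q := Nat.mod_lt _ hq0
  have h2 := mul_pow_le hL (show 2 < 3 by omega)
  refine Spec.mono_cost ((natMod_spec (size_lt_of_le ha.le hpL) hqL).bind_eq
    ((modSub_spec hq hb.le (Nat.mod_lt _ hq0).le).bind_eq
    ((modMul_spec hq (Nat.mod_lt _ hq0).le hv.le).bind_eq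
    ((natMul_spec hpL (size_lt_of_le h1.le hqL)).bind_eq
    (natAdd_spec (size_lt_of_le ha.le hpL) (size_lt_of_le (Nat.mul_le_mul_left p h1.le) hpq)))))) ?_
  omega

/-- The procedure `crt` recovers a residue modulo `p q` from its reductions. -/
lemma crt_value {p q : ℕ} [Fact p.Prime] [Fact q.Prime] (hpq : p ≠ q) {v : ℕ}
    (hv : (v : ZMod q) * p = 1) (t : ZMod (p * q)) :
    (redFst p q t).val + p * (((redSnd p q t).val + q - (redFst p q t).val % q) % q * v % q) =
      t.val := by
  have hp : p.Prime := Fact.out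
  have hq : q.Prime := Fact.out
  have : NeZero (p * q) := ⟨Nat.mul_ne_zero hp.ne_zero hq.ne_zero⟩
  set a := (redFst p q t).val
  set b := (redSnd p q t).val
  set s := (b + q - a % q) % q * v % q with hs
  have ha : a < p := ZMod.val_lt _
  have hsq : s < q := Nat.mod_lt _ hq.pos
  have hlt : a + p * s < p * q := by
    have : p * s + p ≤ p * q := by
      rw [← Nat.mul_succ]
      exact Nat.mul_le_mul_left p hsq
    omega
  have hbij := zmod_prod_bijective ((Nat.coprime_primes hp hq).2 hpq)
  have : ((a + p * s : ℕ) : ZMod (p * q)) = t := by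
    apply hbij.1
    refine Prod.ext ?_ ?_
    · change redFst p q _ = redFst p q t
      rw [map_natCast]
      simp [a]
    · change redSnd p q _ = redSnd p q t
      rw [map_natCast, hs]
      push_cast
      rw [ZMod.natCast_mod, Nat.cast_mul, cast_modSub _ (Nat.mod_lt _ hq.pos).le,
        ZMod.natCast_mod, show (b : ZMod q) = redSnd p q t by simp [b]]
      linear_combination (redSnd p q t - a) * hv
  rw [← this, ZMod.val_natCast, Nat.mod_eq_of_lt hlt]

lemma polyCoeffs_embedMessage {n k r : ℕ} (m : Fin k → ZMod n) (a : ZMod n) (hk : k < r) :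
    (polyCoeffs (embedMessage m a) r).take k = List.ofFn fun i => (m i).val := by
  refine List.ext_getElem (by simp [length_polyCoeffs, hk.le]) fun i hi _ => ?_
  rw [List.getElem_take, getElem_polyCoeffs, List.getElem_ofFn]
  simp only [List.length_take, lt_inf_iff] at hi
  congr 1
  rw [embedMessage, coeff_add, coeff_C_mul, coeff_X_pow, if_neg hi.1.ne, finsetSum_coeff,
    Finset.sum_eq_single ⟨i, hi.1⟩]
  · simp
  · intro j _ hj
    rw [coeff_C_mul, coeff_X_pow, if_neg fun h => hj (Fin.ext h.symm), mul_zero]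
  · simp

end Decryption

section Assembly

lemma four_le_mul_size {n r : ℕ} (hn : 8 ≤ n) (hr : 1 ≤ r) : 4 ≤ r * n.size := by
  have h4 : 3 < n.size := Nat.lt_size.2 hn
  calc 4 = 1 * 4 := rfl
    _ ≤ _ := Nat.mul_le_mul hr h4

/-- A bound on the sizes of all numbers occurring in the computation. -/
lemma bounds_of_le {p n r : ℕ} (hp : p ≤ n) (hn : 8 ≤ n) (hr : 1 ≤ r) :
    Bounds p r (10 * (r * n.size)) := by
  have h4 := four_le_mul_size hn hr
  have h1 : p.size ≤ n.size := Nat.size_le_size hp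
  have h2 : n.size ≤ r * n.size := Nat.le_mul_of_pos_left _ hr
  have h3 : r ≤ r * n.size := Nat.le_mul_of_pos_right _ (Nat.size_pos.2 (by omega))
  have h5 := size_pow_le p r
  have h6 : r * p.size ≤ r * n.size := Nat.mul_le_mul_left r h1
  exact ⟨by omega, by omega, by omega, by omega⟩

lemma nodalOrder_le {p : ℕ} (g : (ZMod p)[X]) : nodalOrder p g ≤ p ^ g.natDegree + 1 := by
  rw [nodalOrder]
  split_ifs <;> omega

lemma size_order_le {p q r a b : ℕ} (hp : 1 ≤ p) (hq : 1 ≤ q) (ha : a ≤ p ^ r + 1)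
    (hb : b ≤ q ^ r + 1) : (a * b).size ≤ r * (p * q).size + 3 := by
  have h1 : a * b ≤ 4 * (p * q) ^ r := by
    have hp' : 1 ≤ p ^ r := Nat.one_le_pow _ _ hp
    have hq' : 1 ≤ q ^ r := Nat.one_le_pow _ _ hq
    calc a * b ≤ (2 * p ^ r) * (2 * q ^ r) := Nat.mul_le_mul (by omega) (by omega)
      _ = _ := by rw [mul_pow]; ring
  rw [Nat.size_le]
  calc a * b ≤ 4 * (p * q) ^ r := h1
    _ ≤ 4 * 2 ^ (r * (p * q).size) := by
      rw [mul_comm r, pow_mul]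
      exact Nat.mul_le_mul_left 4 (Nat.pow_le_pow_left (Nat.lt_size_self _).le r)
    _ < 2 ^ (r * (p * q).size + 3) := by
      rw [pow_add]
      have := Nat.two_pow_pos (r * (p * q).size)
      omega

lemma secretExponent_spec {p q L : ℕ} {fs : List ℕ} {K e : ℕ} (hL : 40 ≤ L)
    (hK : Spec (groupOrder p q fs) (L ^ 10) (· = K)) (hKL : 2 * K.size + 2 ≤ L) (he1 : 1 < e)
    (heK : e < K) (hcop : e.Coprime K) :
    Spec (secretExponent p q fs e) (L ^ 11) (fun d => d < K ∧ e * d ≡ 1 [MOD K]) := by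
  unfold secretExponent
  refine Spec.mono (hK.bind_eq (modInv_spec (by omega) hKL (by omega)
    (size_lt_of_le heK.le (by omega)) hcop)) ?_ fun d hd => ⟨hd.1, ?_⟩
  · have h1 := mul_pow_le hL (show 10 < 11 by omega)
    have h2 := mul_pow_le hL (show 5 < 11 by omega)
    omega
  · rw [← ZMod.natCast_eq_natCast_iff, Nat.cast_mul, Nat.cast_one, mul_comm, hd.2]

variable {p q : ℕ} [hpp : Fact p.Prime] [hqp : Fact q.Prime] {f : (ZMod (p * q))[X]}

lemma pow_eq_self_of_modEq {G : Type*} [Group G] {D : G} {e d : ℕ}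
    (h : e * d ≡ 1 [MOD Nat.card G]) : (D ^ e) ^ d = D := by
  rw [← pow_mul]
  conv_rhs => rw [← pow_one D]
  exact pow_eq_pow_iff_modEq.2 (h.of_dvd (orderOf_dvd_natCard D))

lemma pow_ne_one_of_coprime {G : Type*} [Group G] {D : G} {e : ℕ} (hD : D ≠ 1)
    (h : e.Coprime (Nat.card G)) : D ^ e ≠ 1 := fun h1 =>
  hD (orderOf_eq_one_iff.1 (Nat.Coprime.eq_one_of_dvd
    (Nat.Coprime.coprime_dvd_left (orderOf_dvd_natCard D) h.symm) (orderOf_dvd_of_pow_eq_one h1)))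

lemma eight_le_mul (hp : p ≠ 2) (hq : q ≠ 2) : 8 ≤ p * q := by
  have h1 := hpp.out.two_le
  have h2 := hqp.out.two_le
  have : 3 * 3 ≤ p * q := Nat.mul_le_mul (by omega) (by omega)
  omega

lemma size_lt_of_mem_polyCoeffs {n L r a : ℕ} [NeZero n] {h : (ZMod n)[X]} (hn : n.size < L)
    (ha : a ∈ polyCoeffs h r) : a.size < L :=
  size_lt_of_le (lt_of_mem_polyCoeffs ha).le hn

/-- The Jacobian over `ℤ/pq` is the product of those over `𝔽_p` and `𝔽_q`. -/
lemma nodalJacMap_redFst_redSnd_bijective (hpq : p ≠ q) [Fact (IsUnit f.leadingCoeff)]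
    [Fact (Irreducible (f.map (redFst p q)))] [Fact (Irreducible (f.map (redSnd p q)))] :
    Function.Bijective (fun D : NodalJac f =>
      (nodalJacMap (redFst p q) f D, nodalJacMap (redSnd p q) f D)) :=
  nodalJacMap_prod_bijective
    (zmod_prod_bijective ((Nat.coprime_primes hpp.out hqp.out).2 hpq)) f

/-- The classes that are nontrivial modulo `p` and modulo `q` are those given by admissible
polynomials. -/
lemma exists_represents (hpq : p ≠ q) [hf : Fact (IsUnit f.leadingCoeff)]
    [Fact (Irreducible (f.map (redFst p q)))] [Fact (Irreducible (f.map (redSnd p q)))]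
    {D : NodalJac f} (h₁ : nodalJacMap (redFst p q) f D ≠ 1)
    (h₂ : nodalJacMap (redSnd p q) f D ≠ 1) : ∃ g, IsJacPoly f g ∧ Represents f g D := by
  obtain ⟨g₁, hg₁, e₁⟩ := exists_jacClass h₁
  obtain ⟨g₂, hg₂, e₂⟩ := exists_jacClass h₂
  obtain ⟨g, hg, rfl, rfl⟩ := exists_isJacPoly_of_map
    (zmod_prod_bijective ((Nat.coprime_primes hpp.out hqp.out).2 hpq)) hf.out hg₁ hg₂
  refine ⟨g, hg, ?_⟩
  have hr := (represents_iff f hg _).2 rfl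
  convert hr using 1
  refine (nodalJacMap_redFst_redSnd_bijective hpq).1 (Prod.ext ?_ ?_)
  · exact e₁.symm.trans (nodalJacMap_of_represents hg hr).symm
  · exact e₂.symm.trans (nodalJacMap_of_represents hg hr).symm

lemma represents_unique (hpq : p ≠ q) [hf : Fact (IsUnit f.leadingCoeff)]
    [Fact (Irreducible (f.map (redFst p q)))] [Fact (Irreducible (f.map (redSnd p q)))]
    {D : NodalJac f} {t t' : (ZMod (p * q))[X]} (ht : IsJacPoly f t) (ht' : IsJacPoly f t')
    (h : Represents f t D) (h' : Represents f t' D) : t = t' := by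
  refine eq_of_map_eq_map_eq
    (zmod_prod_bijective ((Nat.coprime_primes hpp.out hqp.out).2 hpq)).1 ?_ ?_
  · exact jacClass_injective _ _
      ((nodalJacMap_of_represents ht h).symm.trans (nodalJacMap_of_represents ht' h'))
  · exact jacClass_injective _ _
      ((nodalJacMap_of_represents ht h).symm.trans (nodalJacMap_of_represents ht' h'))

lemma natDegree_map_of_isUnit_leadingCoeff {R S : Type} [CommRing R] [CommRing S] [Nontrivial S]
    (φ : R →+* S) {f : R[X]} (hf : IsUnit f.leadingCoeff) : (f.map φ).natDegree = f.natDegree :=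
  natDegree_eq_of_degree_eq (degree_map_of_isUnit_leadingCoeff φ hf)

variable {L : ℕ}

lemma groupOrder_spec (hp : p ≠ 2) (hq : q ≠ 2) (hBp : Bounds p f.natDegree L)
    (hBq : Bounds q f.natDegree L) (hL : (p * q).size < L) [hf : Fact (IsUnit f.leadingCoeff)]
    (h0 : IsUnit (f.coeff 0)) [Fact (Irreducible (f.map (redFst p q)))]
    [Fact (Irreducible (f.map (redSnd p q)))] :
    Spec (groupOrder p q (polyCoeffs f (f.natDegree + 1))) (L ^ 10)
      (· = nodalOrder p (f.map (redFst p q)) * nodalOrder q (f.map (redSnd p q))) := by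
  have hp0 : NeZero (p * q) := ⟨Nat.mul_ne_zero hpp.out.ne_zero hqp.out.ne_zero⟩
  have e₁ := natDegree_map_of_isUnit_leadingCoeff (redFst p q) hf.out
  have e₂ := natDegree_map_of_isUnit_leadingCoeff (redSnd p q) hf.out
  have hsz : ∀ a ∈ polyCoeffs f (f.natDegree + 1), a.size < L := fun a ha =>
    size_lt_of_mem_polyCoeffs hL ha
  have hs₁ : (nodalOrder p (f.map (redFst p q))).size < L := by
    have h1 := Nat.size_le_size (nodalOrder_le (f.map (redFst p q)))
    have h2 := size_add_le (le_refl (p ^ f.natDegree)) (Nat.one_le_pow f.natDegree _ hpp.out.pos)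
    have h3 := hBp.card
    rw [e₁] at h1
    omega
  have hs₂ : (nodalOrder q (f.map (redSnd p q))).size < L := by
    have h1 := Nat.size_le_size (nodalOrder_le (f.map (redSnd p q)))
    have h2 := size_add_le (le_refl (q ^ f.natDegree)) (Nat.one_le_pow f.natDegree _ hqp.out.pos)
    have h3 := hBq.card
    rw [e₂] at h1
    omega
  unfold groupOrder
  refine Spec.mono_cost ((localOrder_spec (g := f.map (redFst p q)) (by rwa [e₁]) hp ?_ ?_
    hsz).bind_eq ((localOrder_spec (g := f.map (redSnd p q)) (by rwa [e₂]) hq ?_ ?_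
    hsz).bind_eq (natMul_spec hs₁ hs₂))) ?_
  · rw [coeff_map]; exact (h0.map _).ne_zero
  · rw [e₁, polyCoeffs_map_redFst]
  · rw [coeff_map]; exact (h0.map _).ne_zero
  · rw [e₂, polyCoeffs_map_redSnd]
  · have h1 := mul_pow_le hBp.large (show 9 < 10 by omega)
    have h2 := mul_pow_le hBp.large (show 2 < 10 by omega)
    omega

/-- Decryption is correct because the secret exponent undoes the encryption in the Jacobian over
`ℤ/pq`, hence in both reductions. -/
lemma decrypt_spec (hpq : p ≠ q) (hBp : Bounds p f.natDegree L)
    (hBq : Bounds q f.natDegree L) (hL : (p * q).size < L) [hf : Fact (IsUnit f.leadingCoeff)]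
    [Fact (Irreducible (f.map (redFst p q)))] [Fact (Irreducible (f.map (redSnd p q)))]
    {e : ℕ} {D : NodalJac f} {g t : (ZMod (p * q))[X]}
    (hs : Spec (secretExponent p q (polyCoeffs f (f.natDegree + 1)) e) (L ^ 11)
      (fun d => d.size < L ∧ (D ^ e) ^ d = D))
    (ht : IsJacPoly f t) (htD : Represents f t D) (hg : IsJacPoly f g)
    (hgD : Represents f g (D ^ e)) :
    Spec (decrypt p q (polyCoeffs f (f.natDegree + 1)) e (polyCoeffs g f.natDegree)) (L ^ 12)
      (· = polyCoeffs t f.natDegree) := by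
  have hp0 : NeZero (p * q) := ⟨Nat.mul_ne_zero hpp.out.ne_zero hqp.out.ne_zero⟩
  have e₁ := natDegree_map_of_isUnit_leadingCoeff (redFst p q) hf.out
  have e₂ := natDegree_map_of_isUnit_leadingCoeff (redSnd p q) hf.out
  have hsf : ∀ a ∈ polyCoeffs f (f.natDegree + 1), a.size < L := fun a ha =>
    size_lt_of_mem_polyCoeffs hL ha
  have hsg : ∀ a ∈ polyCoeffs g f.natDegree, a.size < L := fun a ha =>
    size_lt_of_mem_polyCoeffs hL ha
  have hcop : p.Coprime q := (Nat.coprime_primes hpp.out hqp.out).2 hpq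
  have hpL : p.size < L := by have := hBp.size; omega
  unfold decrypt
  refine Spec.mono_cost (hs.bind (c' := L ^ 11 + (L ^ 11 + (L ^ 5 + f.natDegree * L ^ 3)))
    fun d hd => ?_) ?_
  · have h₁ := jacPow_spec (g := f.map (redFst p q)) (L := L) (by rwa [e₁])
      (fs := polyCoeffs f (f.natDegree + 1)) (by rw [e₁, polyCoeffs_map_redFst]) hsf
      (hg.map (redFst p q) hf.out) (gs := polyCoeffs g f.natDegree)
      (by rw [e₁, polyCoeffs_map_redFst]) hsg hd.1
    have h₂ := jacPow_spec (g := f.map (redSnd p q)) (L := L) (by rwa [e₂])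
      (fs := polyCoeffs f (f.natDegree + 1)) (by rw [e₂, polyCoeffs_map_redSnd]) hsf
      (hg.map (redSnd p q) hf.out) (gs := polyCoeffs g f.natDegree)
      (by rw [e₂, polyCoeffs_map_redSnd]) hsg hd.1
    rw [← nodalJacMap_of_represents hg hgD, ← map_pow, hd.2, nodalJacMap_of_represents ht htD,
      jacList_jacClass, e₁] at h₁
    rw [← nodalJacMap_of_represents hg hgD, ← map_pow, hd.2, nodalJacMap_of_represents ht htD,
      jacList_jacClass, e₂] at h₂
    refine h₁.bind_eq (h₂.bind_eq ((modInv_spec (by have := hBp.large; omega) hBq.size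
      hqp.out.one_lt hpL hcop).bind fun v hv => ?_))
    have hz := zipC_spec (l := polyCoeffs (t.map (redFst p q)) f.natDegree)
      (m := polyCoeffs (t.map (redSnd p q)) f.natDegree) fun a ha b hb =>
        crt_spec hBp.large hBp.size hBq.size hL hv.1 (lt_of_mem_polyCoeffs ha)
          (lt_of_mem_polyCoeffs hb)
    rw [length_polyCoeffs, zipWith_polyCoeffs (h'' := t) fun i _ => by
      rw [coeff_map, coeff_map]; exact crt_value hpq hv.2 _] at hz
    exact hz
  · have h0 := hBp.degree
    have h1 := mul_pow_le hBp.large (show 11 < 12 by omega)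
    have h2 := mul_pow_le hBp.large (show 5 < 12 by omega)
    have h3 := mul_pow_le hBp.large (show 4 < 12 by omega)
    have h4 : f.natDegree * L ^ 3 ≤ L * L ^ 3 := Nat.mul_le_mul_right _ (by omega)
    have h5 : L * L ^ 3 = L ^ 4 := by ring
    omega

end Assembly

theorem mainTheorem3 :
    ∃ B E : ℕ, ∀ (p q : ℕ) [Fact p.Prime] [Fact q.Prime], p ≠ 2 → q ≠ 2 → p ≠ q →
      ∀ f : (ZMod (p * q))[X],
        IsUnit f.leadingCoeff → IsUnit (f.coeff 0) →
        Irreducible (f.map (redFst p q)) → Irreducible (f.map (redSnd p q)) →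
        -- the Jacobian over `ℤ/n` is the product of the Jacobians over `𝔽_p` and `𝔽_q`
        Function.Bijective (fun D : NodalJac f =>
          (nodalJacMap (redFst p q) f D, nodalJacMap (redSnd p q) f D)) ∧
        -- the orders
        Nat.card (NodalJac (f.map (redFst p q))) = nodalOrder p (f.map (redFst p q)) ∧
        Nat.card (NodalJac (f.map (redSnd p q))) = nodalOrder q (f.map (redSnd p q)) ∧
        Nat.card (NodalJac f) =
          nodalOrder p (f.map (redFst p q)) * nodalOrder q (f.map (redSnd p q)) ∧
        -- the order is computed from `p`, `q` and `f`
        (groupOrder p q (polyCoeffs f (f.natDegree + 1))).val = Nat.card (NodalJac f) ∧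
        (groupOrder p q (polyCoeffs f (f.natDegree + 1))).cost ≤
          B * (f.natDegree * (p * q).size) ^ E ∧
        -- polynomials represent elements of the Jacobian, uniquely
        (∀ t, IsJacPoly f t → ∃ D, Represents f t D) ∧
        (∀ t t' D, IsJacPoly f t → IsJacPoly f t' → Represents f t D → Represents f t' D →
          t = t') ∧
        -- for every encryption exponent
        ∀ e : ℕ, 1 < e → e < Nat.card (NodalJac f) → e.Coprime (Nat.card (NodalJac f)) →
          -- the decryption exponent is computed
          (secretExponent p q (polyCoeffs f (f.natDegree + 1)) e).val < Nat.card (NodalJac f) ∧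
          e * (secretExponent p q (polyCoeffs f (f.natDegree + 1)) e).val ≡ 1
            [MOD Nat.card (NodalJac f)] ∧
          (secretExponent p q (polyCoeffs f (f.natDegree + 1)) e).cost ≤
            B * (f.natDegree * (p * q).size) ^ E ∧
          -- for every plaintext polynomial `t`, with class `D`
          ∀ t D, IsJacPoly f t → Represents f t D →
            -- the ciphertext `D ^ e` is given by a unique polynomial
            (∃! g, IsJacPoly f g ∧ Represents f g (D ^ e)) ∧
            -- raising the ciphertext to the power `d` gives back the class of `t`
            (D ^ e) ^ (secretExponent p q (polyCoeffs f (f.natDegree + 1)) e).val = D ∧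
            -- the polynomial `t` and the message in it are computed from the ciphertext
            ∀ g, IsJacPoly f g → Represents f g (D ^ e) →
              (decrypt p q (polyCoeffs f (f.natDegree + 1)) e (polyCoeffs g f.natDegree)).val =
                polyCoeffs t f.natDegree ∧
              (decrypt p q (polyCoeffs f (f.natDegree + 1)) e (polyCoeffs g f.natDegree)).cost ≤
                B * (f.natDegree * (p * q).size) ^ E ∧
              ∀ (k : ℕ) (m : Fin k → ZMod (p * q)) (a : ZMod (p * q)),
                k < f.natDegree → t = embedMessage m a →
                ((decrypt p q (polyCoeffs f (f.natDegree + 1)) e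
                  (polyCoeffs g f.natDegree)).val.take k) = List.ofFn fun i => (m i).val := by
  -- the most expensive computation is the decryption, with at most `(10 r size(pq)) ^ 12` steps
  refine ⟨10 ^ 12, 12, fun p q hpp hqp hp2 hq2 hpq f hlc h0 hirr₁ hirr₂ => ?_⟩
  have hf : Fact (IsUnit f.leadingCoeff) := ⟨hlc⟩
  have hf₁ : Fact (Irreducible (f.map (redFst p q))) := ⟨hirr₁⟩
  have hf₂ : Fact (Irreducible (f.map (redSnd p q))) := ⟨hirr₂⟩
  have hp0 : NeZero (p * q) := ⟨Nat.mul_ne_zero hpp.out.ne_zero hqp.out.ne_zero⟩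
  have e₁ := natDegree_map_of_isUnit_leadingCoeff (redFst p q) hlc
  have e₂ := natDegree_map_of_isUnit_leadingCoeff (redSnd p q) hlc
  have hr : 1 ≤ f.natDegree := e₁ ▸ hirr₁.natDegree_pos
  have hpq8 := eight_le_mul (p := p) (q := q) hp2 hq2
  rw [show 10 ^ 12 * (f.natDegree * (p * q).size) ^ 12 = (10 * (f.natDegree * (p * q).size)) ^ 12
    from (mul_pow _ _ _).symm]
  have hsz := four_le_mul_size hpq8 hr
  have hsz' : (p * q).size ≤ f.natDegree * (p * q).size := Nat.le_mul_of_pos_left _ hr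
  have hBp : Bounds p f.natDegree (10 * (f.natDegree * (p * q).size)) :=
    bounds_of_le (Nat.le_mul_of_pos_right _ hqp.out.pos) hpq8 hr
  have hBq : Bounds q f.natDegree (10 * (f.natDegree * (p * q).size)) :=
    bounds_of_le (Nat.le_mul_of_pos_left _ hpp.out.pos) hpq8 hr
  have hL : (p * q).size < 10 * (f.natDegree * (p * q).size) := by omega
  have hbij := nodalJacMap_redFst_redSnd_bijective (f := f) hpq
  have hc₁ : Nat.card (NodalJac (f.map (redFst p q))) = nodalOrder p (f.map (redFst p q)) :=
    card_nodalJac hp2 _ (by rw [coeff_map]; exact (h0.map _).ne_zero)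
  have hc₂ : Nat.card (NodalJac (f.map (redSnd p q))) = nodalOrder q (f.map (redSnd p q)) :=
    card_nodalJac hq2 _ (by rw [coeff_map]; exact (h0.map _).ne_zero)
  have hc : Nat.card (NodalJac f) =
      nodalOrder p (f.map (redFst p q)) * nodalOrder q (f.map (redSnd p q)) := by
    rw [Nat.card_congr (Equiv.ofBijective _ hbij), Nat.card_prod, hc₁, hc₂]
  have hKL : 2 * (Nat.card (NodalJac f)).size + 2 ≤ 10 * (f.natDegree * (p * q).size) := by
    have h₁ := nodalOrder_le (f.map (redFst p q))
    have h₂ := nodalOrder_le (f.map (redSnd p q))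
    rw [e₁] at h₁
    rw [e₂] at h₂
    have := size_order_le hpp.out.pos hqp.out.pos h₁ h₂
    rw [hc]
    omega
  generalize 10 * (f.natDegree * (p * q).size) = L at hBp hBq hL hKL ⊢
  have hgo := groupOrder_spec hp2 hq2 hBp hBq hL h0
  rw [← hc] at hgo
  refine ⟨hbij, hc₁, hc₂, hc, hgo.1, hgo.2.trans (Nat.pow_le_pow_right
    (by have := hBp.large; omega) (by omega)), fun t ht => ⟨_, (represents_iff f ht _).2 rfl⟩,
    fun t t' D ht ht' h h' => represents_unique hpq ht ht' h h', fun e he1 heK hcop => ?_⟩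
  have hse := secretExponent_spec hBp.large hgo hKL he1 heK hcop
  refine ⟨hse.1.1, hse.1.2, hse.2.trans (Nat.pow_le_pow_right
    (by have := hBp.large; omega) (by omega)), fun t D ht htD => ?_⟩
  have hpow := pow_eq_self_of_modEq (D := D) hse.1.2
  refine ⟨?_, hpow, fun g hg hgD => ?_⟩
  · have hcop₁ : e.Coprime (Nat.card (NodalJac (f.map (redFst p q)))) :=
      hcop.coprime_dvd_right ⟨_, by rw [hc, hc₁]⟩
    have hcop₂ : e.Coprime (Nat.card (NodalJac (f.map (redSnd p q)))) :=
      hcop.coprime_dvd_right ⟨nodalOrder p (f.map (redFst p q)), by rw [hc, hc₂, mul_comm]⟩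
    obtain ⟨g, hg, hgD⟩ := exists_represents (f := f) hpq (D := D ^ e)
      (by
        rw [map_pow, nodalJacMap_of_represents ht htD]
        exact pow_ne_one_of_coprime (jacClass_ne_one _) hcop₁)
      (by
        rw [map_pow, nodalJacMap_of_represents ht htD]
        exact pow_ne_one_of_coprime (jacClass_ne_one _) hcop₂)
    exact ⟨g, ⟨hg, hgD⟩, fun g' hg' => represents_unique hpq hg'.1 hg hg'.2 hgD⟩
  · have hdec := decrypt_spec hpq hBp hBq hL
      (hse.mono le_rfl fun d hd =>
        ⟨size_lt_of_le hd.1.le (by omega), pow_eq_self_of_modEq (D := D) hd.2⟩) ht htD hg hgD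
    refine ⟨hdec.1, hdec.2, fun k m a hk hta => ?_⟩
    rw [hdec.1, hta]
    exact polyCoeffs_embedMessage m a hk
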